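/- Let $d\ge 1$, and let $K\subseteq\mathbb{R}^d$ be the closed unit ball centred at the origin, taken either in the maximum norm or in the Euclidean norm. Let $C^1(K)$ be the set of functions $f$ with values in $\mathbb{R}^d$ that are continuously differentiable on some open set containing $K$, let $\mathrm{Zero}(f)=\{x\in K: f(x)=0\}$, and let $$\mathcal{Z}(K)=\{f\in C^1(K):\ \det Df(\alpha)\neq 0 \text{ and } \alpha\notin\partial K \text{ for every } \alpha\in \mathrm{Zero}(f)\}.$$ A $C^1$-name of $f=(f_1,\dots,f_d)$ is a sequence $(P_{k,1},\dots,P_{k,d})_{k\in\mathbb{N}}$ of $d$-tuples of polynomials in $d$ variables with rational coefficients such that $\sup_{x\in K}|f_i(x)-P_{k,i}(x)|+\sup_{x\in K}\|D(f_i-P_{k,i})(x)\|<2^{-k}$ for all $k$ and $i$, where $\|\cdot\|$ is the operator norm with respect to the maximum norm on $\mathbb{R}^d$. Then the operator that assigns to each $f\in\mathcal{Z}(K)$ its zero set and the cardinality of its zero set is computable, uniformly in $f$, in the following sense. There is one algorithm (an oracle program with access to the terms of an infinite sequence) which, when given any $C^1$-name of any $f\in\mathcal{Z}(K)$ and any $n_0\in\mathbb{N}$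 as input, halts and produces a positive integer $n\ge n_0$, a nonnegative integer $\#_0(f)$, and a finite list $C$ of closed axis-parallel hypercubes with rational vertices, such that 1. $\#_0(f)$ is the exact number of zeros of $f$ in $K$ (in particular, this number is finite); 2. each hypercube in $C$ has side length $1/n$, is contained in $K$ and contains exactly one zero of $f$; furthermore $\mathrm{Zero}(f)\subseteq\bigcup C$, and $d_H(\mathrm{Zero}(f),\bigcup C)\le 1/n$, where $d_H$ is the Hausdorff distance with respect to the maximum norm. -/

import Mathlib

open scoped ENNReal

/-! ## Algorithms that read an infinite input -/

/-- Functionals `F` taking an infinite sequence `φ : ℕ → ℕ` (the oracle, readable term by term) and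
a natural number to at most one natural number, computed by one oracle program that does not
depend on `φ`: the clauses of `Nat.Partrec`, and one more for querying the sequence. -/
inductive PartrecFunctional : ((ℕ → ℕ) → ℕ →. ℕ) → Prop
  | zero : PartrecFunctional fun _ _ => Part.some 0
  | succ : PartrecFunctional fun _ n => Part.some (n + 1)
  | left : PartrecFunctional fun _ n => Part.some n.unpair.1
  | right : PartrecFunctional fun _ n => Part.some n.unpair.2
  | oracle : PartrecFunctional fun φ n => Part.some (φ n)
  | pair {F G : (ℕ → ℕ) → ℕ →. ℕ} (hF : PartrecFunctional F) (hG : PartrecFunctional G) :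
      PartrecFunctional fun φ n => Nat.pair <$> F φ n <*> G φ n
  | comp {F G : (ℕ → ℕ) → ℕ →. ℕ} (hF : PartrecFunctional F) (hG : PartrecFunctional G) :
      PartrecFunctional fun φ n => G φ n >>= F φ
  | prec {F G : (ℕ → ℕ) → ℕ →. ℕ} (hF : PartrecFunctional F) (hG : PartrecFunctional G) :
      PartrecFunctional fun φ => Nat.unpaired fun a n =>
        n.rec (F φ a) fun y IH => do
          let i ← IH
          G φ (Nat.pair a (Nat.pair y i))
  | rfind {F : (ℕ → ℕ) → ℕ →. ℕ} (hF : PartrecFunctional F) :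
      PartrecFunctional fun φ a => Nat.rfind fun n => (fun m => m = 0) <$> F φ (Nat.pair a n)

/-- `E` is an algorithm: a single oracle program computes `E P b` (through the encodings of the
types) from the input `b` and the sequence `P`, uniformly in `P` and `b`. -/
def IsAlgorithm {α β γ : Type*} [Primcodable α] [Primcodable β] [Primcodable γ]
    (E : (ℕ → α) → β →. γ) : Prop :=
  ∃ F : (ℕ → ℕ) → ℕ →. ℕ, PartrecFunctional F ∧
    ∀ (P : ℕ → α) (b : β),
      F (fun k => Encodable.encode (P k)) (Encodable.encode b) = (E P b).map Encodable.encode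

/-! ## Codes of rational data -/

/-- The triple `(a, b, c)` is a code of the rational number `(a - b) / (c + 1)`. -/
abbrev RatCode : Type := ℕ × ℕ × ℕ

/-- The rational number with a given code. -/
def RatCode.toRat (q : RatCode) : ℚ := ((q.1 : ℚ) - q.2.1) / (q.2.2 + 1)

/-- A polynomial in `d` variables with rational coefficients, given as a list of terms, each of
them a coefficient and a tuple of exponents. -/
abbrev PolyCode (d : ℕ) : Type := List (RatCode × (Fin d → ℕ))

/-- The polynomial with a given code. -/
noncomputable def PolyCode.toPoly {d : ℕ} (p : PolyCode d) : MvPolynomial (Fin d) ℚ :=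
  (p.map fun t => MvPolynomial.C (RatCode.toRat t.1) * ∏ i, MvPolynomial.X i ^ t.2 i).sum

/-- The lowest vertex of a hypercube, given by codes of its coordinates. -/
abbrev CornerCode (d : ℕ) : Type := Fin d → RatCode

/-- The closed axis-parallel hypercube in `ℝ^d` with side `1 / n` and lowest vertex `a`. -/
def hypercube {d : ℕ} (n : ℕ) (a : CornerCode d) : Set (Fin d → ℝ) :=
  Set.Icc (fun i => ((a i).toRat : ℝ)) (fun i => ((a i).toRat : ℝ) + 1 / (n : ℝ))

/-! ## Functions on the closed unit ball -/

/-- The closed unit ball of `ℝ^d` in the maximum norm. -/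
def maxUnitBall (d : ℕ) : Set (Fin d → ℝ) := {x | ‖x‖ ≤ 1}

/-- The closed unit ball of `ℝ^d` in the Euclidean norm. -/
def euclideanUnitBall (d : ℕ) : Set (Fin d → ℝ) := {x | ‖WithLp.toLp 2 x‖ ≤ 1}

/-- `f` is continuously differentiable on an open set containing `K`. -/
def IsC1On {d : ℕ} (K : Set (Fin d → ℝ)) (f : (Fin d → ℝ) → (Fin d → ℝ)) : Prop :=
  ∃ U : Set (Fin d → ℝ), IsOpen U ∧ K ⊆ U ∧ ContDiffOn ℝ 1 f U

/-- The zeros of `f` in `K`. -/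
def zeroSet {d : ℕ} (K : Set (Fin d → ℝ)) (f : (Fin d → ℝ) → (Fin d → ℝ)) : Set (Fin d → ℝ) :=
  {x | x ∈ K ∧ f x = 0}

/-- The class of `C^1` functions on `K` whose zeros are invertible and off the boundary. -/
def invertibleZeroClass {d : ℕ} (K : Set (Fin d → ℝ)) : Set ((Fin d → ℝ) → (Fin d → ℝ)) :=
  {f | IsC1On K f ∧ ∀ x ∈ zeroSet K f, (fderiv ℝ f x).det ≠ 0 ∧ x ∉ frontier K}

/-- The `C^1` norm over `K` of a real-valued function: the supremum over `K` of the absolute value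
plus the supremum over `K` of the norm of the derivative. -/
noncomputable def c1Norm {d : ℕ} (K : Set (Fin d → ℝ)) (g : (Fin d → ℝ) → ℝ) : ℝ≥0∞ :=
  (⨆ x ∈ K, ‖g x‖ₑ) + ⨆ x ∈ K, ‖fderiv ℝ g x‖ₑ

/-- `P` is a `C^1`-name of `f` on `K`: the `k`-th entry consists of one rational polynomial for each
component of `f`, at `C^1`-distance less than `2^(-k)` from that component. -/
def IsC1Name {d : ℕ} (K : Set (Fin d → ℝ)) (f : (Fin d → ℝ) → (Fin d → ℝ))
    (P : ℕ → Fin d → PolyCode d) : Prop :=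
  ∀ (k : ℕ) (i : Fin d),
    c1Norm K (fun x => f x i - MvPolynomial.aeval x (P k i).toPoly) < (2⁻¹ : ℝ≥0∞) ^ k

/-!
The algorithm searches through all certificates `(k, m, n, L)`, where `L` is a list of cubes of side
`1 / (n + 1)`, each with a rational matrix `A`, and returns the cubes of the first certificate that
passes a test. Such a search is an algorithm as soon as the test is primitive recursive in the
certificate, in `n₀` and in the term `P` with number `k` of the name (`isAlgorithm_searchFor`). The
test only does arithmetic on codes of rational numbers: it evaluates `P` and its partial derivatives
on finite meshes, and it compares with explicit Lipschitz constants of these polynomials on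
`[-1, 1]^d` (`PolyCode.abs_fn_sub_le`). It asks for the following.

* The cubes lie in `K` (`BallTests`) and are pairwise disjoint, so that their number is the number
  of zeros (`encard_zeroSet_eq_length`).
* On each cube the entries of `1 - A * DP` are small and `A P` is small at the centre. Then
  `x ↦ x - A f(x)` is a contraction of the cube, and its only fixed point is the only zero of `f`
  there (`existsUnique_zero_of_newton`, `NewtonTest.existsUnique`).
* Every point of a mesh of `[-1, 1]^d` is away from `K`, or well inside one of the cubes, or such
  that `P` is so large there that `f` has no zero nearby. Then all zeros lie in the cubes
  (`CoverTest.subset`).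

The bound on the Hausdorff distance follows, as each cube contains a zero and has diameter
`1 / (n + 1)` in the maximum norm.

Conversely, some certificate passes (`exists_accepts`). The zeros of `f` are interior points of `K`
with invertible derivative, hence isolated, and finite in number by compactness. For each of them a
rational `A` close to the inverse of the derivative makes `1 - A * Df` small on a ball. The cubes
are centred near the zeros and much smaller than these balls, so that they are disjoint; outside of
them `‖f‖` has a positive minimum. All conditions hold with room to spare for `f`, hence also for a
good enough approximation `P` of `f` in the `C^1` norm, and on meshes that are fine enough for `P`.
-/

/-! ### Oracle programs -/

/-- A primitive recursive function is computed by an oracle program that never queries. -/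
theorem PartrecFunctional.of_primrec {g : ℕ → ℕ} (hg : Nat.Primrec g) :
    PartrecFunctional fun _ n => Part.some (g n) := by
  induction hg with
  | zero => exact .zero
  | succ => exact .succ
  | left => exact .left
  | right => exact .right
  | pair _ _ ihf ihg =>
    convert ihf.pair ihg using 3
    simp [Seq.seq]
  | comp _ _ ihf ihg =>
    convert ihf.comp ihg using 3
    simp
  | @prec f g _ _ ihf ihg =>
    refine cast (congrArg PartrecFunctional (funext fun φ => funext fun n => ?_)) (ihf.prec ihg)
    simp only [Nat.unpaired]
    induction n.unpair.2 with
    | zero => rfl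
    | succ k ih => exact (congrArg (Part.bind · _) ih).trans (Part.bind_some _ _)

/-- Unbounded search for a natural number that passes a primitive recursive test is an algorithm,
even if the test may look at one term of the sequence, at a position that depends primitive
recursively on the candidate. -/
theorem IsAlgorithm.search {α β γ : Type*} [Primcodable α] [Primcodable β] [Primcodable γ]
    {query : ℕ → ℕ} {test : α × β × ℕ → Bool} {out : ℕ → γ}
    (hq : Primrec query) (ht : Primrec test) (ho : Primrec out) :
    IsAlgorithm fun (P : ℕ → α) (b : β) =>
      (Nat.rfind fun m => Part.some (test (P (query m), b, m))).map out := by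
  -- The test on codes: `w` codes the pair of `z = ⟨input, candidate⟩` and the answer to the query.
  let code : ℕ → ℕ := fun w =>
    bif ((Encodable.decode (α := α) w.unpair.2).bind fun a =>
      (Encodable.decode (α := β) w.unpair.1.unpair.1).map fun b =>
        test (a, b, w.unpair.1.unpair.2)).getD false then 0 else 1
  have hcode : Primrec code := by
    have h1 : Primrec fun w : ℕ => w.unpair.1 := Primrec.fst.comp Primrec.unpair
    have h2 : Primrec fun w : ℕ => w.unpair.2 := Primrec.snd.comp Primrec.unpair
    refine Primrec.cond (Primrec.option_getD.comp (Primrec.option_bind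
      (Primrec.decode.comp h2) ?_) (Primrec.const false)) (Primrec.const 0) (Primrec.const 1)
    refine Primrec.option_map (Primrec.decode.comp (h1.comp (h1.comp Primrec.fst))) ?_
    exact ht.comp (Primrec.pair (Primrec.snd.comp Primrec.fst)
      (Primrec.pair Primrec.snd (h2.comp (h1.comp (Primrec.fst.comp Primrec.fst)))))
  have hq' : Primrec fun z : ℕ => query z.unpair.2 :=
    hq.comp (Primrec.snd.comp Primrec.unpair)
  have hC : PartrecFunctional fun φ z => Part.some (code (Nat.pair z (φ (query z.unpair.2)))) := by
    have := (PartrecFunctional.of_primrec (Primrec.nat_iff.1 hcode)).comp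
      ((PartrecFunctional.of_primrec Nat.Primrec.id).pair
        (PartrecFunctional.oracle.comp (PartrecFunctional.of_primrec (Primrec.nat_iff.1 hq'))))
    convert this using 3
    simp [Seq.seq]
  refine ⟨_, (PartrecFunctional.of_primrec
    (Primrec.nat_iff.1 (Primrec.encode.comp ho))).comp hC.rfind, fun P b => ?_⟩
  have : (fun n => (fun m => decide (m = 0)) <$>
      Part.some (code (Nat.pair (Nat.pair (Encodable.encode b) n)
        (Encodable.encode (P (query (Nat.pair (Encodable.encode b) n).unpair.2)))))) =
      fun m => Part.some (test (P (query m), b, m)) := by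
    funext m
    simp only [code, Nat.unpair_pair, Encodable.encodek, Option.bind_some, Option.map_some,
      Option.getD_some, Part.map_eq_map, Part.map_some]
    cases test (P (query m), b, m) <;> simp
  rw [this, Part.map_map, Part.bind_eq_bind, Part.bind_some_eq_map]
  rfl

/-! ### Closure properties of primitive recursion -/

theorem Primrec.apply_fin {α β : Type*} [Primcodable α] [Primcodable β] {d : ℕ}
    {f : α → Fin d → β} (hf : Primrec f) (i : Fin d) : Primrec fun x => f x i :=
  (Primrec.fin_app.comp hf (Primrec.const i) :)

theorem Primrec.lam_fin {α β : Type*} [Primcodable α] [Primcodable β] {d : ℕ}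
    {f : α → Fin d → β} (hf : ∀ i, Primrec fun x => f x i) : Primrec f :=
  Primrec.fin_curry.2 (Primrec.fin_curry₁ (f := fun i x => f x i).2 hf).swap

/-- A fold over a fixed list of indices is primitive recursive if each step is. -/
theorem Primrec.foldr_const {α β ι : Type*} [Primcodable α] [Primcodable β]
    {f : ι → α → β → β} (hf : ∀ i, Primrec fun z : α × β => f i z.1 z.2) (b : β) (l : List ι) :
    Primrec fun x => l.foldr (fun i s => f i x s) b := by
  induction l with
  | nil => exact Primrec.const b
  | cons i l ih => exact (hf i).comp (Primrec.pair Primrec.id ih)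

theorem Primrec.nat_pow : Primrec₂ ((· ^ ·) : ℕ → ℕ → ℕ) :=
  Primrec₂.unpaired'.1 Nat.Primrec.pow

theorem PrimrecPred.const {α : Type*} [Primcodable α] (p : Prop) :
    PrimrecPred fun _ : α => p := by
  classical
  exact ⟨fun _ => inferInstance, Primrec.const _⟩

theorem PrimrecPred.forall_fin {α : Type*} [Primcodable α] {d : ℕ} {p : Fin d → α → Prop}
    (hp : ∀ i, PrimrecPred (p i)) : PrimrecPred fun x => ∀ i, p i x := by
  have (l : List (Fin d)) : PrimrecPred fun x => ∀ i ∈ l, p i x := by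
    induction l with
    | nil => exact (PrimrecPred.const True).of_eq (by simp)
    | cons i l ih => exact ((hp i).and ih).of_eq (by simp)
  exact (this (List.finRange d)).of_eq (by simp)

theorem PrimrecPred.exists_fin {α : Type*} [Primcodable α] {d : ℕ} {p : Fin d → α → Prop}
    (hp : ∀ i, PrimrecPred (p i)) : PrimrecPred fun x => ∃ i, p i x :=
  (PrimrecPred.forall_fin fun i => (hp i).not).not.of_eq (by simp)

theorem PrimrecPred.forall_mem {α β : Type*} [Primcodable α] [Primcodable β] {f : α → List β}
    {p : α → β → Prop} (hf : Primrec f) (hp : PrimrecPred fun z : α × β => p z.1 z.2) :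
    PrimrecPred fun x => ∀ b ∈ f x, p x b :=
  (PrimrecRel.forall_mem_list (R := fun b a => p a b)
    (hp.comp (Primrec.pair Primrec.snd Primrec.fst))).comp hf Primrec.id

theorem PrimrecPred.exists_mem {α β : Type*} [Primcodable α] [Primcodable β] {f : α → List β}
    {p : α → β → Prop} (hf : Primrec f) (hp : PrimrecPred fun z : α × β => p z.1 z.2) :
    PrimrecPred fun x => ∃ b ∈ f x, p x b :=
  (PrimrecRel.exists_mem_list (R := fun b a => p a b)
    (hp.comp (Primrec.pair Primrec.snd Primrec.fst))).comp hf Primrec.id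

theorem PrimrecPred.forall_nat_lt {α : Type*} [Primcodable α] {f : α → ℕ}
    {p : α → ℕ → Prop} (hf : Primrec f) (hp : PrimrecPred fun z : α × ℕ => p z.1 z.2) :
    PrimrecPred fun x => ∀ t < f x, p x t :=
  (PrimrecPred.forall_mem (Primrec.list_range.comp hf) hp).of_eq (by simp)

theorem PrimrecPred.pairwise {α β : Type*} [Primcodable α] [Primcodable β] {f : α → List β}
    {p : α → β → β → Prop} (hf : Primrec f)
    (hp : PrimrecPred fun z : α × β × β => p z.1 z.2.1 z.2.2) :
    PrimrecPred fun x => (f x).Pairwise (p x) := by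
  classical
  have h : Primrec fun x => List.rec (motive := fun _ => Bool) true
      (fun b l r => decide (∀ c ∈ l, p x b c) && r) (f x) := by
    refine Primrec.list_rec hf (Primrec.const true)
      (h := fun x z => decide (∀ c ∈ z.2.1, p x z.1 c) && z.2.2) ?_
    refine Primrec.and.comp (PrimrecPred.decide ?_)
      (Primrec.snd.comp (Primrec.snd.comp Primrec.snd))
    refine PrimrecPred.forall_mem (f := fun z : α × β × List β × Bool => z.2.2.1)
      (p := fun z c => p z.1 z.2.1 c)
      (Primrec.fst.comp (Primrec.snd.comp Primrec.snd)) ?_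
    exact hp.comp (Primrec.pair (Primrec.fst.comp Primrec.fst) (Primrec.pair
      (Primrec.fst.comp (Primrec.snd.comp Primrec.fst)) Primrec.snd))
  refine ⟨fun _ => inferInstance, h.of_eq fun x => ?_⟩
  beta_reduce
  induction f x with
  | nil => simp
  | cons b l ih =>
    simp only [ih, List.pairwise_cons, Bool.decide_and]

/-! ### Unbounded search -/

open scoped Classical in
/-- The search for some `c : δ` that passes the test `test a b c`, where `a` is the term number
`query c` of the sequence; it returns `out c`. -/
noncomputable def searchFor {α β γ δ : Type*} [Primcodable δ] [Inhabited γ] (query : δ → ℕ)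
    (test : α → β → δ → Prop) (out : δ → γ) (P : ℕ → α) (b : β) : Part γ :=
  (Nat.rfind fun t => Part.some (decide (∃ c ∈ (Encodable.decode t : Option δ),
    test (P (query c)) b c))).map fun t => ((Encodable.decode t : Option δ).map out).getD default

theorem isAlgorithm_searchFor {α β γ δ : Type*} [Primcodable α] [Primcodable β] [Primcodable γ]
    [Primcodable δ] [Inhabited γ] {query : δ → ℕ} {test : α → β → δ → Prop} {out : δ → γ}
    (hq : Primrec query) (ht : PrimrecPred fun z : α × β × δ => test z.1 z.2.1 z.2.2)
    (ho : Primrec out) : IsAlgorithm (searchFor query test out) := by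
  classical
  have hq' : Primrec fun t : ℕ => ((Encodable.decode t : Option δ).map query).getD 0 :=
    Primrec.option_getD.comp (Primrec.option_map Primrec.decode (hq.comp Primrec.snd))
      (Primrec.const 0)
  have ht' : Primrec fun z : α × β × ℕ =>
      decide (∃ c ∈ (Encodable.decode z.2.2 : Option δ), test z.1 z.2.1 c) := by
    refine PrimrecPred.decide ?_
    refine (PrimrecPred.exists_mem (f := fun z : α × β × ℕ =>
      (Encodable.decode z.2.2 : Option δ).toList)
      (p := fun z c => test z.1 z.2.1 c) ?_ ?_).of_eq (by simp)
    · exact Primrec.optionToList.comp (Primrec.decode.comp (Primrec.snd.comp Primrec.snd))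
    · exact ht.comp (Primrec.pair (Primrec.fst.comp Primrec.fst)
        (Primrec.pair (Primrec.fst.comp (Primrec.snd.comp Primrec.fst)) Primrec.snd))
  have ho' : Primrec fun t : ℕ => ((Encodable.decode t : Option δ).map out).getD default :=
    Primrec.option_getD.comp (Primrec.option_map Primrec.decode (ho.comp Primrec.snd))
      (Primrec.const _)
  obtain ⟨F, hF, h⟩ := IsAlgorithm.search hq' ht' ho'
  refine ⟨F, hF, fun P b => (h P b).trans ?_⟩
  rw [searchFor]
  beta_reduce
  congr 3
  funext t
  rcases (Encodable.decode t : Option δ) with _ | c <;> simp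

/-- The search succeeds if some `c` passes the test, and its output then comes from such a `c`. -/
theorem exists_mem_searchFor {α β γ δ : Type*} [Primcodable δ] [Inhabited γ] {query : δ → ℕ}
    {test : α → β → δ → Prop} {out : δ → γ} {P : ℕ → α} {b : β}
    (h : ∃ c, test (P (query c)) b c) :
    ∃ c, test (P (query c)) b c ∧ out c ∈ searchFor query test out P b := by
  classical
  obtain ⟨c, hc⟩ := h
  have hdom : (Nat.rfind fun t => Part.some (decide
      (∃ c ∈ (Encodable.decode t : Option δ), test (P (query c)) b c))).Dom := by
    refine Nat.rfind_dom'.2 ⟨Encodable.encode c, ?_, fun _ => trivial⟩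
    simpa using hc
  obtain ⟨t, ht⟩ := Part.dom_iff_mem.1 hdom
  obtain ⟨c', hc', htest⟩ := of_decide_eq_true (Part.mem_some_iff.1 (Nat.rfind_spec ht)).symm
  refine ⟨c', htest, (Part.mem_map_iff _).2 ⟨t, ?_, ?_⟩⟩
  · convert ht
  · rw [Option.mem_def] at hc'
    simp [hc']

/-! ### Arithmetic on codes of rational numbers -/

namespace RatCode

/-- Code of the sum of the coded numbers. -/
def add (p q : RatCode) : RatCode :=
  (p.1 * (q.2.2 + 1) + q.1 * (p.2.2 + 1), p.2.1 * (q.2.2 + 1) + q.2.1 * (p.2.2 + 1),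
    p.2.2 * q.2.2 + p.2.2 + q.2.2)

/-- Code of the product of the coded numbers. -/
def mul (p q : RatCode) : RatCode :=
  (p.1 * q.1 + p.2.1 * q.2.1, p.1 * q.2.1 + p.2.1 * q.1, p.2.2 * q.2.2 + p.2.2 + q.2.2)

/-- Code of the opposite of the coded number. -/
def neg (p : RatCode) : RatCode := (p.2.1, p.1, p.2.2)

/-- The comparison of the coded numbers, cleared of denominators. -/
def Le (p q : RatCode) : Prop :=
  p.1 * (q.2.2 + 1) + q.2.1 * (p.2.2 + 1) ≤ q.1 * (p.2.2 + 1) + p.2.1 * (q.2.2 + 1)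

/-- Code of a power of the coded number. -/
def pow (p : RatCode) (n : ℕ) : RatCode := n.rec (1, 0, 0) fun _ q => mul q p

/-- A natural number that bounds the absolute value of the coded number. -/
def bound (p : RatCode) : ℕ := p.1 + p.2.1

/-- Code of the sum of finitely many coded numbers. -/
def sum {d : ℕ} (v : Fin d → RatCode) : RatCode :=
  (List.finRange d).foldr (fun i s => add (v i) s) (0, 0, 0)

/-- Code of the product of finitely many coded numbers. -/
def prod {d : ℕ} (v : Fin d → RatCode) : RatCode :=
  (List.finRange d).foldr (fun i s => mul (v i) s) (1, 0, 0)

theorem toRat_add (p q : RatCode) : (add p q).toRat = p.toRat + q.toRat := by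
  simp only [add, toRat]
  push_cast
  field_simp
  ring

theorem toRat_mul (p q : RatCode) : (mul p q).toRat = p.toRat * q.toRat := by
  simp only [mul, toRat]
  push_cast
  field_simp
  ring

theorem toRat_neg (p : RatCode) : (neg p).toRat = -p.toRat := by
  simp only [neg, toRat]
  ring

theorem le_iff (p q : RatCode) : Le p q ↔ p.toRat ≤ q.toRat := by
  simp only [Le, toRat]
  rw [div_le_div_iff₀ (by positivity) (by positivity), ← Nat.cast_le (α := ℚ)]
  push_cast
  constructor <;> intro h <;> linarith

theorem toRat_natCast (n m : ℕ) : toRat (n, 0, m) = n / (m + 1) := by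
  simp [toRat]

theorem toRat_pow (p : RatCode) (n : ℕ) : (pow p n).toRat = p.toRat ^ n := by
  induction n with
  | zero => simp [pow, toRat]
  | succ n ih => rw [pow_succ, ← ih, ← toRat_mul]; rfl

theorem toRat_sum {d : ℕ} (v : Fin d → RatCode) : (sum v).toRat = ∑ i, (v i).toRat := by
  rw [← Fin.sum_ofFn, List.ofFn_eq_map, sum]
  induction List.finRange d with
  | nil => simp [toRat]
  | cons i l ih => simp [toRat_add, ih]

theorem toRat_prod {d : ℕ} (v : Fin d → RatCode) : (prod v).toRat = ∏ i, (v i).toRat := by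
  rw [← Fin.prod_ofFn, List.ofFn_eq_map, prod]
  induction List.finRange d with
  | nil => simp [toRat]
  | cons i l ih => simp [toRat_mul, ih]

theorem abs_toRat_le_bound (p : RatCode) : |p.toRat| ≤ p.bound := by
  have h1 : (0 : ℚ) ≤ p.1 := by positivity
  have h2 : (0 : ℚ) ≤ p.2.1 := by positivity
  have h3 : (0 : ℚ) ≤ p.2.2 := by positivity
  simp only [toRat, bound]
  rw [abs_div, abs_of_pos (by positivity : (0 : ℚ) < p.2.2 + 1), div_le_iff₀ (by positivity)]
  push_cast
  rw [abs_le]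
  constructor <;> nlinarith

theorem toRat_surjective : Function.Surjective toRat := by
  intro q
  refine ⟨(q.num.toNat, (-q.num).toNat, q.den - 1), ?_⟩
  have h : ((q.den - 1 : ℕ) : ℚ) + 1 = q.den := by
    exact_mod_cast Nat.sub_add_cancel q.pos
  simp only [toRat, h]
  conv_rhs => rw [← Rat.num_div_den q]
  congr 1
  have : ((q.num.toNat : ℤ) : ℚ) - (((-q.num).toNat : ℤ) : ℚ) = q.num := by
    exact_mod_cast (by omega : (q.num.toNat : ℤ) - ((-q.num).toNat : ℤ) = q.num)
  exact_mod_cast this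

section Primrec

variable {α : Type*} [Primcodable α]

theorem primrec_mk {f g h : α → ℕ} (hf : Primrec f) (hg : Primrec g) (hh : Primrec h) :
    Primrec fun x => ((f x, g x, h x) : RatCode) :=
  Primrec.pair hf (Primrec.pair hg hh)

theorem primrec_nat {f g : α → ℕ} (hf : Primrec f) (hg : Primrec g) :
    Primrec fun x => ((f x, 0, g x) : RatCode) :=
  primrec_mk hf (Primrec.const 0) hg

theorem primrec_add {f g : α → RatCode} (hf : Primrec f) (hg : Primrec g) :
    Primrec fun x => add (f x) (g x) := by
  have f1 := Primrec.fst.comp hf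
  have f2 := Primrec.fst.comp (Primrec.snd.comp hf)
  have f3 := Primrec.snd.comp (Primrec.snd.comp hf)
  have g1 := Primrec.fst.comp hg
  have g2 := Primrec.fst.comp (Primrec.snd.comp hg)
  have g3 := Primrec.snd.comp (Primrec.snd.comp hg)
  exact primrec_mk
    (Primrec.nat_add.comp (Primrec.nat_mul.comp f1 (Primrec.succ.comp g3))
      (Primrec.nat_mul.comp g1 (Primrec.succ.comp f3)))
    (Primrec.nat_add.comp (Primrec.nat_mul.comp f2 (Primrec.succ.comp g3))
      (Primrec.nat_mul.comp g2 (Primrec.succ.comp f3)))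
    (Primrec.nat_add.comp (Primrec.nat_add.comp (Primrec.nat_mul.comp f3 g3) f3) g3)

theorem primrec_mul {f g : α → RatCode} (hf : Primrec f) (hg : Primrec g) :
    Primrec fun x => mul (f x) (g x) := by
  have f1 := Primrec.fst.comp hf
  have f2 := Primrec.fst.comp (Primrec.snd.comp hf)
  have f3 := Primrec.snd.comp (Primrec.snd.comp hf)
  have g1 := Primrec.fst.comp hg
  have g2 := Primrec.fst.comp (Primrec.snd.comp hg)
  have g3 := Primrec.snd.comp (Primrec.snd.comp hg)
  exact primrec_mk
    (Primrec.nat_add.comp (Primrec.nat_mul.comp f1 g1) (Primrec.nat_mul.comp f2 g2))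
    (Primrec.nat_add.comp (Primrec.nat_mul.comp f1 g2) (Primrec.nat_mul.comp f2 g1))
    (Primrec.nat_add.comp (Primrec.nat_add.comp (Primrec.nat_mul.comp f3 g3) f3) g3)

theorem primrec_neg {f : α → RatCode} (hf : Primrec f) : Primrec fun x => neg (f x) :=
  primrec_mk (Primrec.fst.comp (Primrec.snd.comp hf)) (Primrec.fst.comp hf)
    (Primrec.snd.comp (Primrec.snd.comp hf))

theorem primrec_bound {f : α → RatCode} (hf : Primrec f) : Primrec fun x => bound (f x) :=
  Primrec.nat_add.comp (Primrec.fst.comp hf) (Primrec.fst.comp (Primrec.snd.comp hf))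

theorem primrec_pow {f : α → RatCode} {g : α → ℕ} (hf : Primrec f) (hg : Primrec g) :
    Primrec fun x => pow (f x) (g x) :=
  Primrec.nat_rec' (h := fun x z => mul z.2 (f x)) hg (Primrec.const (1, 0, 0))
    (primrec_mul (Primrec.snd.comp Primrec.snd) (hf.comp Primrec.fst))

theorem primrec_sum {d : ℕ} {f : α → Fin d → RatCode} (hf : ∀ i, Primrec fun x => f x i) :
    Primrec fun x => sum (f x) :=
  Primrec.foldr_const (f := fun i x s => add (f x i) s)
    (fun i => primrec_add ((hf i).comp Primrec.fst) Primrec.snd) _ _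

theorem primrec_prod {d : ℕ} {f : α → Fin d → RatCode} (hf : ∀ i, Primrec fun x => f x i) :
    Primrec fun x => prod (f x) :=
  Primrec.foldr_const (f := fun i x s => mul (f x i) s)
    (fun i => primrec_mul ((hf i).comp Primrec.fst) Primrec.snd) _ _

theorem primrecPred_le {f g : α → RatCode} (hf : Primrec f) (hg : Primrec g) :
    PrimrecPred fun x => Le (f x) (g x) := by
  have f1 := Primrec.fst.comp hf
  have f2 := Primrec.fst.comp (Primrec.snd.comp hf)
  have f3 := Primrec.snd.comp (Primrec.snd.comp hf)
  have g1 := Primrec.fst.comp hg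
  have g2 := Primrec.fst.comp (Primrec.snd.comp hg)
  have g3 := Primrec.snd.comp (Primrec.snd.comp hg)
  exact Primrec.nat_le.comp
    (Primrec.nat_add.comp (Primrec.nat_mul.comp f1 (Primrec.succ.comp g3))
      (Primrec.nat_mul.comp g2 (Primrec.succ.comp f3)))
    (Primrec.nat_add.comp (Primrec.nat_mul.comp g1 (Primrec.succ.comp f3))
      (Primrec.nat_mul.comp f2 (Primrec.succ.comp g3)))

/-- The test `|p| ≤ q` on codes. -/
def AbsLe (p q : RatCode) : Prop := Le p q ∧ Le (neg p) q

theorem absLe_iff (p q : RatCode) : AbsLe p q ↔ |p.toRat| ≤ q.toRat := by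
  rw [AbsLe, le_iff, le_iff, toRat_neg, abs_le', neg_le]

theorem primrecPred_absLe {f g : α → RatCode} (hf : Primrec f) (hg : Primrec g) :
    PrimrecPred fun x => AbsLe (f x) (g x) :=
  (primrecPred_le hf hg).and (primrecPred_le (primrec_neg hf) hg)

end Primrec

end RatCode

/-! ### Evaluation and differentiation of coded polynomials -/

/-- The point of `ℝ^d` whose coordinates have the given codes. -/
def CornerCode.toReal {d : ℕ} (a : CornerCode d) : Fin d → ℝ := fun i => ((a i).toRat : ℝ)

/-- The real function given by a coded polynomial. -/
noncomputable def PolyCode.fn {d : ℕ} (p : PolyCode d) (x : Fin d → ℝ) : ℝ :=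
  MvPolynomial.aeval x p.toPoly

namespace PolyCode

variable {d : ℕ}

/-- Code of the value of a coded polynomial at a coded point. -/
def eval (p : PolyCode d) (x : CornerCode d) : RatCode :=
  p.foldr (fun t s => .add (.mul t.1 (.prod fun i => .pow (x i) (t.2 i))) s) (0, 0, 0)

/-- Code of the partial derivative of a coded polynomial. -/
def deriv (l : Fin d) (p : PolyCode d) : PolyCode d :=
  p.map fun t => (.mul t.1 (t.2 l, 0, 0), fun i => if i = l then t.2 i - 1 else t.2 i)

/-- A bound of a coded polynomial on the cube `[-1, 1]^d`: the sum of bounds of its coefficients. -/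
def bound (p : PolyCode d) : ℕ := p.foldr (fun t s => t.1.bound + s) 0

/-- A Lipschitz constant of a coded polynomial on the cube `[-1, 1]^d`, in the maximum norm. -/
def lip (p : PolyCode d) : ℕ := (List.finRange d).foldr (fun l s => (p.deriv l).bound + s) 0

theorem fn_nil (x : Fin d → ℝ) : fn [] x = 0 := by simp [fn, toPoly]

theorem fn_cons (t : RatCode × (Fin d → ℕ)) (p : PolyCode d) (x : Fin d → ℝ) :
    fn (t :: p) x = t.1.toRat * ∏ i, x i ^ t.2 i + fn p x := by
  simp [fn, toPoly]

theorem toRat_eval (p : PolyCode d) (x : CornerCode d) :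
    ((p.eval x).toRat : ℝ) = p.fn x.toReal := by
  induction p with
  | nil => simp [eval, fn_nil, RatCode.toRat]
  | cons t p ih =>
    rw [fn_cons, ← ih]
    simp [eval, RatCode.toRat_add, RatCode.toRat_mul, RatCode.toRat_prod, RatCode.toRat_pow,
      CornerCode.toReal]

theorem lip_eq (p : PolyCode d) : p.lip = ∑ l, (p.deriv l).bound := by
  rw [← Fin.sum_ofFn, List.ofFn_eq_map, lip]
  induction List.finRange d with
  | nil => simp
  | cons i l ih => simp [ih]

theorem abs_fn_le_bound (p : PolyCode d) {x : Fin d → ℝ} (hx : ∀ i, |x i| ≤ 1) :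
    |p.fn x| ≤ bound p := by
  induction p with
  | nil => simp [fn_nil, bound]
  | cons t p ih =>
    rw [fn_cons]
    have h1 : |((t.1.toRat : ℚ) : ℝ)| ≤ t.1.bound := by exact_mod_cast t.1.abs_toRat_le_bound
    have h2 : |∏ i, x i ^ t.2 i| ≤ 1 := by
      rw [Finset.abs_prod]
      exact Finset.prod_le_one (fun i _ => abs_nonneg _) fun i _ => by
        rw [abs_pow]; exact pow_le_one₀ (abs_nonneg _) (hx i)
    have h3 : (bound (t :: p) : ℝ) = t.1.bound + bound p := by simp [bound]
    rw [h3]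
    refine (abs_add_le _ _).trans (add_le_add ?_ ih)
    rw [abs_mul]
    calc _ ≤ (t.1.bound : ℝ) * 1 := by gcongr
      _ = _ := mul_one _

theorem hasFDerivAt_fn (p : PolyCode d) (x : Fin d → ℝ) :
    HasFDerivAt p.fn
      (∑ l, (p.deriv l).fn x • ContinuousLinearMap.proj (R := ℝ) (φ := fun _ => ℝ) l) x := by
  induction p with
  | nil =>
    have : (fn [] : (Fin d → ℝ) → ℝ) = fun _ => 0 := funext fn_nil
    rw [this]
    simpa [deriv, fn_nil] using hasFDerivAt_const (0 : ℝ) x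
  | cons t p ih =>
    have e : fn (t :: p) = fun x => t.1.toRat * ∏ i, x i ^ t.2 i + fn p x := funext (fn_cons t p)
    rw [e]
    have h (i : Fin d) : HasFDerivAt (fun x : Fin d → ℝ => x i ^ t.2 i)
        (((t.2 i : ℝ) * x i ^ (t.2 i - 1)) •
          ContinuousLinearMap.proj (R := ℝ) (φ := fun _ => ℝ) i) x := by
      simpa using (hasFDerivAt_apply (𝕜 := ℝ) i x).pow (t.2 i)
    refine (((HasFDerivAt.finsetProd (u := Finset.univ) fun i _ => h i).const_mul
      (t.1.toRat : ℝ)).add ih).congr_fderiv ?_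
    rw [Finset.smul_sum, ← Finset.sum_add_distrib]
    refine Finset.sum_congr rfl fun l _ => ?_
    have : (deriv l (t :: p)) = (.mul t.1 (t.2 l, 0, 0),
        fun i => if i = l then t.2 i - 1 else t.2 i) :: deriv l p := rfl
    rw [this, fn_cons, add_smul, RatCode.toRat_mul, RatCode.toRat_natCast,
      ← Finset.mul_prod_erase _ _ (Finset.mem_univ l), smul_smul, smul_smul]
    congr 2
    have hprod : ∏ i ∈ Finset.univ.erase l, x i ^ (if i = l then t.2 i - 1 else t.2 i) =
        ∏ i ∈ Finset.univ.erase l, x i ^ t.2 i :=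
      Finset.prod_congr rfl fun i hi => by rw [if_neg (Finset.ne_of_mem_erase hi)]
    rw [hprod]
    simp
    ring

theorem fderiv_fn_single (p : PolyCode d) (x : Fin d → ℝ) (l : Fin d) :
    fderiv ℝ p.fn x (Pi.single l 1) = (p.deriv l).fn x := by
  rw [(p.hasFDerivAt_fn x).fderiv]
  simp [Pi.single_apply]

theorem abs_fn_sub_le (p : PolyCode d) {x y : Fin d → ℝ} (hx : ∀ i, |x i| ≤ 1)
    (hy : ∀ i, |y i| ≤ 1) : |p.fn x - p.fn y| ≤ p.lip * ‖x - y‖ := by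
  have hs : Convex ℝ (Set.Icc (fun _ : Fin d => (-1 : ℝ)) fun _ => 1) := convex_Icc _ _
  have mem (z : Fin d → ℝ) : z ∈ Set.Icc (fun _ : Fin d => (-1 : ℝ)) (fun _ => 1) ↔
      ∀ i, |z i| ≤ 1 := by
    simp [Set.mem_Icc, Pi.le_def, abs_le, forall_and]
  rw [← Real.norm_eq_abs]
  refine hs.norm_image_sub_le_of_norm_hasFDerivWithin_le
    (fun z _ => (p.hasFDerivAt_fn z).hasFDerivWithinAt) (fun z hz => ?_)
    ((mem y).2 hy) ((mem x).2 hx)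
  refine (norm_sum_le _ _).trans ?_
  rw [lip_eq, Nat.cast_sum]
  refine Finset.sum_le_sum fun l _ => ?_
  rw [norm_smul]
  calc _ ≤ ((p.deriv l).bound : ℝ) * 1 := by
        gcongr
        · exact abs_fn_le_bound _ ((mem z).1 hz)
        · refine ContinuousLinearMap.opNorm_le_bound _ zero_le_one fun v => ?_
          simpa using norm_le_pi_norm v l
    _ = _ := mul_one _

section Primrec

variable {α : Type*} [Primcodable α]

theorem primrec_eval {f : α → PolyCode d} {g : α → CornerCode d} (hf : Primrec f)
    (hg : Primrec g) : Primrec fun x => eval (f x) (g x) := by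
  refine Primrec.list_foldr (h := fun x z =>
    RatCode.add (.mul z.1.1 (.prod fun i => .pow (g x i) (z.1.2 i))) z.2) hf (Primrec.const _) ?_
  have ht : Primrec fun z : α × (RatCode × (Fin d → ℕ)) × RatCode => z.2.1 :=
    Primrec.fst.comp Primrec.snd
  exact RatCode.primrec_add (RatCode.primrec_mul (Primrec.fst.comp ht)
    (RatCode.primrec_prod fun i => RatCode.primrec_pow ((hg.comp Primrec.fst).apply_fin i)
      ((Primrec.snd.comp ht).apply_fin i))) (Primrec.snd.comp Primrec.snd)

theorem primrec_deriv {f : α → PolyCode d} (hf : Primrec f) (l : Fin d) :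
    Primrec fun x => deriv l (f x) := by
  refine Primrec.list_map hf (g := fun _ t =>
    ((t.1.mul (t.2 l, 0, 0), fun i => if i = l then t.2 i - 1 else t.2 i) :
      RatCode × (Fin d → ℕ))) ?_
  have h2 (i : Fin d) : Primrec fun z : α × (RatCode × (Fin d → ℕ)) => z.2.2 i :=
    (Primrec.snd.comp Primrec.snd).apply_fin i
  refine Primrec.pair (RatCode.primrec_mul (Primrec.fst.comp Primrec.snd)
    (RatCode.primrec_nat (h2 l) (Primrec.const 0))) (Primrec.lam_fin fun i => ?_)
  by_cases h : i = l
  · simpa [h] using Primrec.pred.comp (h2 l)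
  · simpa [h] using h2 i

theorem primrec_bound {f : α → PolyCode d} (hf : Primrec f) :
    Primrec fun x => bound (f x) :=
  Primrec.list_foldr (h := fun _ (z : (RatCode × (Fin d → ℕ)) × ℕ) => z.1.1.bound + z.2) hf
    (Primrec.const 0)
    (Primrec.nat_add.comp (RatCode.primrec_bound (Primrec.fst.comp (Primrec.fst.comp Primrec.snd)))
      (Primrec.snd.comp Primrec.snd))

theorem primrec_lip {f : α → PolyCode d} (hf : Primrec f) : Primrec fun x => lip (f x) :=
  Primrec.foldr_const (f := fun l x s => ((f x).deriv l).bound + s)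
    (fun l => Primrec.nat_add.comp (primrec_bound (primrec_deriv (hf.comp Primrec.fst) l))
      Primrec.snd) _ _

end Primrec

end PolyCode

/-! ### Tests for the two unit balls -/

/-- What the search has to know about the set `K`: it is a compact subset of the cube `[-1, 1]^d`,
`inside n a` is a decidable condition that ensures that the cube of side `1 / (n + 1)` at `a` lies
in `K`, and `outside m x` is one that ensures that `K` does not meet the cube of radius
`1 / (m + 1)` around `x`. Both tests succeed whenever there is enough room. -/
structure BallTests {d : ℕ} (K : Set (Fin d → ℝ)) (inside outside : ℕ → CornerCode d → Prop) :
    Prop where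
  isCompact : IsCompact K
  abs_le : ∀ x ∈ K, ∀ i, |x i| ≤ 1
  primrec_inside : PrimrecPred fun z : ℕ × CornerCode d => inside z.1 z.2
  primrec_outside : PrimrecPred fun z : ℕ × CornerCode d => outside z.1 z.2
  inside_sound : ∀ n a, inside n a → hypercube (n + 1) a ⊆ K
  inside_complete : ∀ α ∈ interior K, ∃ n₁, ∀ n ≥ n₁, ∀ a, α ∈ hypercube (n + 1) a → inside n a
  outside_sound : ∀ m x, outside m x → ∀ y ∈ K,
    ¬ ∀ i, |y i - CornerCode.toReal x i| ≤ 1 / ((m : ℝ) + 1)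
  outside_complete : ∀ m x, ¬ outside m x → (∀ i, |CornerCode.toReal x i| ≤ 1) →
    ∃ y ∈ K, ∀ i, |y i - CornerCode.toReal x i| ≤ d / ((m : ℝ) + 1)

theorem mem_hypercube_iff {d n : ℕ} {a : CornerCode d} {x : Fin d → ℝ} :
    x ∈ hypercube (n + 1) a ↔ ∀ i, a.toReal i ≤ x i ∧ x i ≤ a.toReal i + 1 / ((n : ℝ) + 1) := by
  simp [hypercube, Set.mem_Icc, Pi.le_def, CornerCode.toReal, forall_and]

theorem exists_smul_mem_of_mem_interior {d : ℕ} {K : Set (Fin d → ℝ)} {α : Fin d → ℝ}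
    (hα : α ∈ interior K) : ∃ t : ℝ, 0 < t ∧ (1 + t) • α ∈ K := by
  have hc : Filter.Tendsto (fun t : ℝ => (1 + t) • α) (nhds 0) (nhds α) := by
    have : Continuous fun t : ℝ => (1 + t) • α := by fun_prop
    simpa using this.tendsto 0
  have h := hc.eventually (mem_interior_iff_mem_nhds.1 hα)
  obtain ⟨ε, hε, h⟩ := Metric.eventually_nhds_iff.1 h
  refine ⟨ε / 2, by positivity, h ?_⟩
  rw [Real.dist_eq, sub_zero, abs_of_pos (by positivity)]
  linarith

theorem lt_one_of_mul_le_one {r t : ℝ} (ht : 0 < t) (h : (1 + t) * r ≤ 1) : r < 1 := by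
  by_contra! h'
  nlinarith

theorem exists_forall_ge_div_le {ε : ℝ} (hε : 0 < ε) (c : ℝ) :
    ∃ n₁ : ℕ, ∀ n ≥ n₁, c / ((n : ℝ) + 1) ≤ ε := by
  obtain ⟨n₁, h⟩ := exists_nat_ge (c / ε)
  refine ⟨n₁, fun n hn => ?_⟩
  have hn' : (n₁ : ℝ) ≤ n := by exact_mod_cast hn
  rw [div_le_iff₀ (by positivity)]
  rw [div_le_iff₀ hε] at h
  nlinarith

theorem ballTests_maxUnitBall (d : ℕ) :
    BallTests (maxUnitBall d)
      (fun n a => ∀ i, RatCode.Le (0, 1, 0) (a i) ∧ RatCode.Le ((a i).add (1, 0, n)) (1, 0, 0))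
      (fun _ _ => False) where
  isCompact := by
    have : maxUnitBall d = Metric.closedBall 0 1 := by ext; simp [maxUnitBall]
    rw [this]
    exact isCompact_closedBall _ _
  abs_le x hx i := (norm_le_pi_norm x i).trans hx
  primrec_inside := by
    have h (i : Fin d) : Primrec fun z : ℕ × CornerCode d => z.2 i := Primrec.snd.apply_fin i
    exact PrimrecPred.forall_fin fun i =>
      (RatCode.primrecPred_le (Primrec.const _) (h i)).and
      (RatCode.primrecPred_le (RatCode.primrec_add (h i)
        (RatCode.primrec_nat (Primrec.const 1) Primrec.fst)) (Primrec.const _))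
  primrec_outside := PrimrecPred.const False
  inside_sound n a h x hx := by
    rw [mem_hypercube_iff] at hx
    refine (pi_norm_le_iff_of_nonneg zero_le_one).2 fun i => abs_le.2 ?_
    obtain ⟨h1, h2⟩ := h i
    rw [RatCode.le_iff] at h1 h2
    rw [RatCode.toRat_add] at h2
    have h1' : (-1 : ℝ) ≤ a.toReal i := by
      have : ((-1 : ℚ) : ℝ) ≤ a.toReal i := Rat.cast_le.2 (by simpa [RatCode.toRat] using h1)
      simpa using this
    have h2' : a.toReal i + 1 / ((n : ℝ) + 1) ≤ 1 := by
      have : (((a i).toRat + 1 / ((n : ℚ) + 1) : ℚ) : ℝ) ≤ ((1 : ℚ) : ℝ) :=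
        Rat.cast_le.2 (by simpa [RatCode.toRat] using h2)
      simpa [CornerCode.toReal] using this
    exact ⟨by linarith [(hx i).1], by linarith [(hx i).2]⟩
  inside_complete α hα := by
    obtain ⟨t, ht, h⟩ := exists_smul_mem_of_mem_interior hα
    have hlt : ‖α‖ < 1 := by
      refine lt_one_of_mul_le_one ht ?_
      have : ‖(1 + t) • α‖ ≤ 1 := h
      rwa [norm_smul, Real.norm_of_nonneg (by positivity)] at this
    obtain ⟨n₁, hn₁⟩ := exists_forall_ge_div_le (sub_pos.2 hlt) 1
    refine ⟨n₁, fun n hn a ha i => ?_⟩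
    have hi := abs_le.1 ((norm_le_pi_norm α i).trans' (le_of_eq (Real.norm_eq_abs _).symm))
    have hn' := hn₁ n hn
    obtain ⟨h1, h2⟩ := mem_hypercube_iff.1 ha i
    rw [RatCode.le_iff, RatCode.le_iff, RatCode.toRat_add]
    constructor
    · have : ((-1 : ℚ) : ℝ) ≤ ((a i).toRat : ℝ) := by
        simp only [CornerCode.toReal] at h1 h2
        push_cast
        linarith
      simpa [RatCode.toRat] using Rat.cast_le.1 this
    · have : (((a i).toRat + 1 / ((n : ℚ) + 1) : ℚ) : ℝ) ≤ ((1 : ℚ) : ℝ) := by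
        simp only [CornerCode.toReal] at h1 h2
        push_cast
        linarith
      simpa [RatCode.toRat] using Rat.cast_le.1 this
  outside_sound _ _ h := h.elim
  outside_complete m x _ hx := by
    refine ⟨x.toReal, (pi_norm_le_iff_of_nonneg zero_le_one).2 hx, fun i => ?_⟩
    rw [sub_self, abs_zero]
    positivity

theorem norm_toLp_le_of_abs_le {d : ℕ} {v : Fin d → ℝ} {r : ℝ} (hv : ∀ i, |v i| ≤ r)
    (hr : 0 ≤ r) : ‖WithLp.toLp 2 v‖ ≤ d * r := by
  refine abs_le_of_sq_le_sq' ?_ (by positivity) |>.2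
  rw [EuclideanSpace.norm_sq_eq]
  calc ∑ i, ‖v i‖ ^ 2 ≤ ∑ _i : Fin d, r ^ 2 := by
        refine Finset.sum_le_sum fun i _ => ?_
        exact pow_le_pow_left₀ (norm_nonneg _) (hv i) 2
    _ = d * r ^ 2 := by simp
    _ ≤ (d : ℝ) ^ 2 * r ^ 2 := by
        gcongr
        exact_mod_cast Nat.le_self_pow two_ne_zero d
    _ = (d * r) ^ 2 := by ring

/-- Code of the square of the Euclidean norm of a coded point. -/
def CornerCode.normSq {d : ℕ} (a : CornerCode d) : RatCode := .sum fun i => (a i).mul (a i)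

theorem CornerCode.toRat_normSq {d : ℕ} (a : CornerCode d) :
    ((a.normSq.toRat : ℚ) : ℝ) = ‖WithLp.toLp 2 a.toReal‖ ^ 2 := by
  rw [EuclideanSpace.norm_sq_eq, normSq, RatCode.toRat_sum]
  simp only [RatCode.toRat_mul, toReal, Real.norm_eq_abs, sq_abs]
  push_cast
  simp only [sq]

theorem CornerCode.primrec_normSq {α : Type*} [Primcodable α] {d : ℕ} {f : α → CornerCode d}
    (hf : Primrec f) : Primrec fun x => (f x).normSq :=
  RatCode.primrec_sum fun i => RatCode.primrec_mul (hf.apply_fin i) (hf.apply_fin i)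

/-- The comparison of `‖a‖` with `s / (n + 1)`, squared and cleared of denominators. -/
theorem CornerCode.le_normSq_iff {d : ℕ} (a : CornerCode d) (n s : ℕ) :
    RatCode.Le (a.normSq.mul ((n + 1) ^ 2, 0, 0)) (s ^ 2, 0, 0) ↔
      ‖WithLp.toLp 2 a.toReal‖ ≤ s / ((n : ℝ) + 1) := by
  rw [RatCode.le_iff, ← Rat.cast_le (K := ℝ), RatCode.toRat_mul, RatCode.toRat_natCast,
    RatCode.toRat_natCast, Rat.cast_mul, toRat_normSq, le_div_iff₀ (by positivity)]
  conv_rhs => rw [← pow_le_pow_iff_left₀ (by positivity) (by positivity) two_ne_zero, mul_pow]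
  simp

theorem ballTests_euclideanUnitBall (d : ℕ) :
    BallTests (euclideanUnitBall d)
      (fun n a => d ≤ n + 1 ∧
        RatCode.Le ((CornerCode.normSq a).mul ((n + 1) ^ 2, 0, 0)) ((n + 1 - d) ^ 2, 0, 0))
      (fun m x =>
        ¬ RatCode.Le ((CornerCode.normSq x).mul ((m + 1) ^ 2, 0, 0)) ((m + 1 + d) ^ 2, 0, 0)) where
  isCompact := by
    have : euclideanUnitBall d =
        (PiLp.continuousLinearEquiv 2 ℝ fun _ : Fin d => ℝ) ''
          Metric.closedBall (0 : EuclideanSpace ℝ (Fin d)) 1 := by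
      ext x
      constructor
      · intro hx
        exact ⟨WithLp.toLp 2 x, by simpa [euclideanUnitBall] using hx, rfl⟩
      · rintro ⟨y, hy, rfl⟩
        exact mem_closedBall_zero_iff.1 hy
    rw [this]
    exact (isCompact_closedBall _ _).image (ContinuousLinearEquiv.continuous _)
  abs_le x hx i := (PiLp.norm_apply_le (WithLp.toLp 2 x) i).trans hx
  primrec_inside := by
    have hs : Primrec fun z : ℕ × CornerCode d => z.1 + 1 := Primrec.succ.comp Primrec.fst
    refine (Primrec.nat_le.comp (Primrec.const d) hs).and (RatCode.primrecPred_le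
      (RatCode.primrec_mul (CornerCode.primrec_normSq Primrec.snd) (RatCode.primrec_nat ?_ ?_))
      (RatCode.primrec_nat ?_ ?_))
    · exact Primrec.nat_pow.comp hs (Primrec.const 2)
    · exact Primrec.const 0
    · exact Primrec.nat_pow.comp (Primrec.nat_sub.comp hs (Primrec.const d)) (Primrec.const 2)
    · exact Primrec.const 0
  primrec_outside := by
    have hs : Primrec fun z : ℕ × CornerCode d => z.1 + 1 := Primrec.succ.comp Primrec.fst
    refine PrimrecPred.not (RatCode.primrecPred_le
      (RatCode.primrec_mul (CornerCode.primrec_normSq Primrec.snd) (RatCode.primrec_nat ?_ ?_))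
      (RatCode.primrec_nat ?_ ?_))
    · exact Primrec.nat_pow.comp hs (Primrec.const 2)
    · exact Primrec.const 0
    · exact Primrec.nat_pow.comp (Primrec.nat_add.comp hs (Primrec.const d)) (Primrec.const 2)
    · exact Primrec.const 0
  inside_sound := by
    rintro n a ⟨hd, h⟩ x hx
    rw [mem_hypercube_iff] at hx
    rw [CornerCode.le_normSq_iff, Nat.cast_sub hd] at h
    have h1 : ‖WithLp.toLp 2 (x - a.toReal)‖ ≤ d * (1 / ((n : ℝ) + 1)) :=
      norm_toLp_le_of_abs_le (fun i => by
        rw [Pi.sub_apply, abs_of_nonneg (by linarith [(hx i).1])]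
        linarith [(hx i).2]) (by positivity)
    have h2 : WithLp.toLp 2 x = WithLp.toLp 2 a.toReal + WithLp.toLp 2 (x - a.toReal) := by
      rw [← WithLp.toLp_add]; simp
    have h3 : ((n + 1 : ℕ) - (d : ℝ)) / ((n : ℝ) + 1) + d * (1 / ((n : ℝ) + 1)) = 1 := by
      push_cast; field_simp; ring
    change ‖WithLp.toLp 2 x‖ ≤ 1
    rw [h2, ← h3]
    exact (norm_add_le _ _).trans (add_le_add h h1)
  inside_complete α hα := by
    obtain ⟨t, ht, h⟩ := exists_smul_mem_of_mem_interior hα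
    have hlt : ‖WithLp.toLp 2 α‖ < 1 := by
      refine lt_one_of_mul_le_one ht ?_
      have : ‖WithLp.toLp 2 ((1 + t) • α)‖ ≤ 1 := h
      rwa [WithLp.toLp_smul, norm_smul, Real.norm_of_nonneg (by positivity)] at this
    obtain ⟨n₁, hn₁⟩ := exists_forall_ge_div_le (sub_pos.2 hlt) (2 * d)
    refine ⟨n₁ + d, fun n hn a ha => ?_⟩
    have hd : d ≤ n + 1 := by omega
    refine ⟨hd, ?_⟩
    rw [CornerCode.le_normSq_iff, Nat.cast_sub hd]
    have hn' := hn₁ n (by omega)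
    rw [mem_hypercube_iff] at ha
    have h1 : ‖WithLp.toLp 2 (a.toReal - α)‖ ≤ d * (1 / ((n : ℝ) + 1)) :=
      norm_toLp_le_of_abs_le (fun i => by
        rw [Pi.sub_apply, abs_of_nonpos (by linarith [(ha i).1])]
        linarith [(ha i).2]) (by positivity)
    have h2 : WithLp.toLp 2 a.toReal = WithLp.toLp 2 α + WithLp.toLp 2 (a.toReal - α) := by
      rw [← WithLp.toLp_add]; simp
    have h3 : ((n + 1 : ℕ) - (d : ℝ)) / ((n : ℝ) + 1) =
        1 - 2 * d / ((n : ℝ) + 1) + d * (1 / ((n : ℝ) + 1)) := by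
      push_cast; field_simp; ring
    rw [h2, h3]
    refine (norm_add_le _ _).trans (add_le_add ?_ h1)
    linarith
  outside_sound m x h y hy hyx := by
    rw [CornerCode.le_normSq_iff, not_le] at h
    have h1 : ‖WithLp.toLp 2 (x.toReal - y)‖ ≤ d * (1 / ((m : ℝ) + 1)) :=
      norm_toLp_le_of_abs_le (fun i => by rw [Pi.sub_apply, abs_sub_comm]; exact hyx i)
        (by positivity)
    have h2 : WithLp.toLp 2 x.toReal = WithLp.toLp 2 y + WithLp.toLp 2 (x.toReal - y) := by
      rw [← WithLp.toLp_add]; simp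
    have h3 : ((m + 1 + d : ℕ) : ℝ) / ((m : ℝ) + 1) = 1 + d * (1 / ((m : ℝ) + 1)) := by
      push_cast; field_simp
    rw [h2, h3] at h
    exact absurd ((norm_add_le _ _).trans (add_le_add hy h1)) (not_le.2 h)
  outside_complete m x h hx := by
    rw [not_not, CornerCode.le_normSq_iff] at h
    have hs : (0 : ℝ) < (m + 1 + d : ℕ) / ((m : ℝ) + 1) := by positivity
    -- The witness is the radial contraction of `x` that maps the larger ball onto `K`.
    refine ⟨((m + 1 + d : ℕ) / ((m : ℝ) + 1))⁻¹ • x.toReal, ?_, fun i => ?_⟩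
    · change ‖WithLp.toLp 2 (_ • x.toReal)‖ ≤ 1
      rw [WithLp.toLp_smul, norm_smul, Real.norm_of_nonneg (inv_nonneg.2 hs.le),
        inv_mul_le_iff₀ hs, mul_one]
      exact h
    · rw [Pi.smul_apply, smul_eq_mul, ← sub_one_mul, abs_mul]
      have h3 : |((m + 1 + d : ℕ) / ((m : ℝ) + 1))⁻¹ - 1| ≤ d / ((m : ℝ) + 1) := by
        have : ((m + 1 + d : ℕ) / ((m : ℝ) + 1))⁻¹ - 1 = -(d / ((m : ℝ) + 1 + d)) := by
          push_cast; field_simp; ring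
        rw [this, abs_neg, abs_of_nonneg (by positivity)]
        exact div_le_div_of_nonneg_left (by positivity) (by positivity)
          (by linarith [d.cast_nonneg (α := ℝ)])
      calc _ ≤ d / ((m : ℝ) + 1) * 1 := by
            gcongr
            exact hx i
        _ = _ := mul_one _

/-! ### Certificates and their verification -/

/-- A candidate for one cube of the output: its lowest vertex, and a rational matrix meant to
approximate the inverse of the derivative at the zero in the cube. -/
abbrev Cell (d : ℕ) : Type := CornerCode d × (Fin d → Fin d → RatCode)

/-- A certificate `(k, m, n, L)`: the term `k` of the name is used, meshes are refined `m + 1`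
times, and the list `L` consists of cubes of side `1 / (n + 1)`. -/
abbrev Certificate (d : ℕ) : Type := ℕ × ℕ × ℕ × List (Cell d)

/-- The `t`-th point of the mesh of width `1 / (s + 1)` with `B` points on each edge and lowest
point `a`: its coordinates are given by the digits of `t` in base `B`. -/
def meshPoint {d : ℕ} (a : CornerCode d) (s B t : ℕ) : CornerCode d :=
  fun i => (a i).add (t / B ^ (i : ℕ) % B, 0, s)

/-- The centre of the cube of side `1 / (n + 1)` with lowest vertex `a`. -/
def cubeCenter {d : ℕ} (n : ℕ) (a : CornerCode d) : CornerCode d :=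
  fun i => (a i).add (1, 0, 2 * n + 1)

/-- The entry of `1 - A * DP` in row `i` and column `l`, at the point `x`. -/
def newtonDefectCode {d : ℕ} (P : Fin d → PolyCode d) (A : Fin d → Fin d → RatCode)
    (x : CornerCode d) (i l : Fin d) : RatCode :=
  .add (if i = l then (1, 0, 0) else (0, 0, 0))
    (.neg (.sum fun j => (A i j).mul (((P j).deriv l).eval x)))

/-- The test that the Newton-like map `x ↦ x - A f(x)` maps a cube into itself and contracts it.
It evaluates the approximation `P` of `f` at the centre of the cube and its derivative on a mesh;
the two conditions on natural numbers say that the errors are small. -/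
def NewtonTest {d : ℕ} (P : Fin d → PolyCode d) (k m n : ℕ) (e : Cell d) : Prop :=
  (∀ i, RatCode.AbsLe (.sum fun j => (e.2 i j).mul ((P j).eval (cubeCenter n e.1)))
    (1, 0, 8 * n + 7)) ∧
  (∀ i j, 8 * (n + 1) * d * (e.2 i j).bound ≤ 2 ^ k) ∧
  (∀ i j l, 8 * d ^ 2 * (e.2 i j).bound * (m + 1 + 2 ^ k * ((P j).deriv l).lip) ≤
    2 ^ k * (m + 1)) ∧
  ∀ t < (m + 2) ^ d, ∀ i l,
    RatCode.AbsLe (newtonDefectCode P e.2 (meshPoint e.1 ((n + 1) * (m + 1) - 1) (m + 2) t) i l)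
      (1, 0, 8 * d - 1)

/-- The test that the cube of radius `1 / (m + 1)` around `x` lies in a cube of the list `L`. -/
def InteriorTest {d : ℕ} (m n : ℕ) (L : List (Cell d)) (x : CornerCode d) : Prop :=
  ∃ e ∈ L, ∀ i, RatCode.Le ((e.1 i).add (1, 0, m)) (x i) ∧
    RatCode.Le ((x i).add (1, 0, m)) ((e.1 i).add (1, 0, n))

/-- The test that a function approximated by `P` has no zero within `1 / (m + 1)` of `x`. -/
def NonzeroTest {d : ℕ} (P : Fin d → PolyCode d) (k m : ℕ) (x : CornerCode d) : Prop :=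
  ∃ i, ¬ RatCode.AbsLe ((P i).eval x) (m + 1 + 2 ^ k * (P i).lip, 0, 2 ^ k * (m + 1) - 1)

/-- The test that all zeros lie in the cubes of the list `L`, on a mesh of `[-1, 1]^d`. -/
def CoverTest {d : ℕ} (outside : ℕ → CornerCode d → Prop) (P : Fin d → PolyCode d) (k m n : ℕ)
    (L : List (Cell d)) : Prop :=
  ∀ t < (2 * (m + 1) + 1) ^ d,
    outside m (meshPoint (fun _ => (0, 1, 0)) m (2 * (m + 1) + 1) t) ∨
    NonzeroTest P k m (meshPoint (fun _ => (0, 1, 0)) m (2 * (m + 1) + 1) t) ∨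
    InteriorTest m n L (meshPoint (fun _ => (0, 1, 0)) m (2 * (m + 1) + 1) t)

/-- The test that two cubes of side `1 / (n + 1)` are disjoint, by comparing one coordinate. -/
def Separated {d : ℕ} (n : ℕ) (a b : CornerCode d) : Prop :=
  ∃ i, ¬ RatCode.Le (b i) ((a i).add (1, 0, n)) ∨ ¬ RatCode.Le (a i) ((b i).add (1, 0, n))

/-- The verification of the certificate `c`: the side `1 / (n + 1)` of its cubes satisfies
`n₀ ≤ n + 1`, and the cubes are pairwise disjoint, lie in `K`, contain one zero each and all zeros
together. Here `P` is the term of the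
name that `c` asks for. -/
def Accepts {d : ℕ} (inside outside : ℕ → CornerCode d → Prop) (P : Fin d → PolyCode d) (n₀ : ℕ)
    (c : Certificate d) : Prop :=
  n₀ ≤ c.2.2.1 + 1 ∧
  c.2.2.2.Pairwise (fun e e' => Separated c.2.2.1 e.1 e'.1) ∧
  (∀ e ∈ c.2.2.2, inside c.2.2.1 e.1 ∧ NewtonTest P c.1 c.2.1 c.2.2.1 e) ∧
  CoverTest outside P c.1 c.2.1 c.2.2.1 c.2.2.2

section Primrec

variable {α : Type*} [Primcodable α] {d : ℕ}

theorem primrec_meshPoint {a : α → CornerCode d} {s B t : α → ℕ} (ha : Primrec a)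
    (hs : Primrec s) (hB : Primrec B) (ht : Primrec t) :
    Primrec fun x => meshPoint (a x) (s x) (B x) (t x) :=
  Primrec.lam_fin fun i => RatCode.primrec_add (ha.apply_fin i) (RatCode.primrec_nat
    (Primrec.nat_mod.comp (Primrec.nat_div.comp ht
      (Primrec.nat_pow.comp hB (Primrec.const (i : ℕ)))) hB) hs)

theorem primrec_cubeCenter {a : α → CornerCode d} {n : α → ℕ} (hn : Primrec n)
    (ha : Primrec a) : Primrec fun x => cubeCenter (n x) (a x) :=
  Primrec.lam_fin fun i => RatCode.primrec_add (ha.apply_fin i) (RatCode.primrec_nat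
    (Primrec.const 1) (Primrec.nat_double_succ.comp hn))

theorem primrec_newtonDefectCode {P : α → Fin d → PolyCode d} {A : α → Fin d → Fin d → RatCode}
    {y : α → CornerCode d} (hP : Primrec P) (hA : Primrec A) (hy : Primrec y) (i l : Fin d) :
    Primrec fun x => newtonDefectCode (P x) (A x) (y x) i l :=
  RatCode.primrec_add (Primrec.const _) (RatCode.primrec_neg (RatCode.primrec_sum fun j =>
    RatCode.primrec_mul ((hA.apply_fin i).apply_fin j)
      (PolyCode.primrec_eval (PolyCode.primrec_deriv (hP.apply_fin j) l) hy)))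

theorem primrec_two_pow {k : α → ℕ} (hk : Primrec k) : Primrec fun x => 2 ^ k x :=
  Primrec.nat_pow.comp (Primrec.const 2) hk

theorem primrecPred_newtonTest {P : α → Fin d → PolyCode d} {k m n : α → ℕ} {e : α → Cell d}
    (hP : Primrec P) (hk : Primrec k) (hm : Primrec m) (hn : Primrec n) (he : Primrec e) :
    PrimrecPred fun x => NewtonTest (P x) (k x) (m x) (n x) (e x) := by
  have ha : Primrec fun x => (e x).1 := Primrec.fst.comp he
  have hA : Primrec fun x => (e x).2 := Primrec.snd.comp he
  have hA' (i j : Fin d) : Primrec fun x => (e x).2 i j := (hA.apply_fin i).apply_fin j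
  have hm1 : Primrec fun x => m x + 1 := Primrec.succ.comp hm
  have hn1 : Primrec fun x => n x + 1 := Primrec.succ.comp hn
  have hc (c : ℕ) : Primrec fun _ : α => c := Primrec.const c
  refine PrimrecPred.and ?_ (PrimrecPred.and ?_ (PrimrecPred.and ?_ ?_))
  · refine PrimrecPred.forall_fin fun i => RatCode.primrecPred_absLe
      (RatCode.primrec_sum fun j => RatCode.primrec_mul (hA' i j)
        (PolyCode.primrec_eval (hP.apply_fin j) (primrec_cubeCenter hn ha)))
      (RatCode.primrec_nat (hc 1) ?_)
    exact Primrec.nat_add.comp (Primrec.nat_mul.comp (hc 8) hn) (hc 7)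
  · exact PrimrecPred.forall_fin fun i => PrimrecPred.forall_fin fun j =>
      Primrec.nat_le.comp (Primrec.nat_mul.comp (Primrec.nat_mul.comp
        (Primrec.nat_mul.comp (hc 8) hn1) (hc d)) (RatCode.primrec_bound (hA' i j)))
        (primrec_two_pow hk)
  · exact PrimrecPred.forall_fin fun i => PrimrecPred.forall_fin fun j =>
      PrimrecPred.forall_fin fun l => Primrec.nat_le.comp
        (Primrec.nat_mul.comp (Primrec.nat_mul.comp (hc (8 * d ^ 2))
          (RatCode.primrec_bound (hA' i j)))
          (Primrec.nat_add.comp hm1 (Primrec.nat_mul.comp (primrec_two_pow hk)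
            (PolyCode.primrec_lip (PolyCode.primrec_deriv (hP.apply_fin j) l)))))
        (Primrec.nat_mul.comp (primrec_two_pow hk) hm1)
  · have hm2 : Primrec fun x => m x + 2 := Primrec.succ.comp hm1
    refine PrimrecPred.forall_nat_lt (Primrec.nat_pow.comp hm2 (hc d))
      (PrimrecPred.forall_fin fun i => PrimrecPred.forall_fin fun l =>
        RatCode.primrecPred_absLe (primrec_newtonDefectCode (hP.comp Primrec.fst)
          (hA.comp Primrec.fst) (primrec_meshPoint (ha.comp Primrec.fst) ?_
            (hm2.comp Primrec.fst) Primrec.snd) i l)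
          (Primrec.const _))
    exact Primrec.pred.comp (Primrec.nat_mul.comp (hn1.comp Primrec.fst) (hm1.comp Primrec.fst))

theorem primrecPred_interiorTest {m n : α → ℕ} {L : α → List (Cell d)} {y : α → CornerCode d}
    (hm : Primrec m) (hn : Primrec n) (hL : Primrec L) (hy : Primrec y) :
    PrimrecPred fun x => InteriorTest (m x) (n x) (L x) (y x) := by
  refine PrimrecPred.exists_mem hL (PrimrecPred.forall_fin fun i => ?_)
  have he : Primrec fun z : α × Cell d => z.2.1 i :=
    (Primrec.fst.comp Primrec.snd).apply_fin i
  have hy' : Primrec fun z : α × Cell d => y z.1 i := (hy.comp Primrec.fst).apply_fin i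
  have h1 {f : α → ℕ} (hf : Primrec f) :
      Primrec fun z : α × Cell d => ((1, 0, f z.1) : RatCode) :=
    RatCode.primrec_nat (Primrec.const 1) (hf.comp Primrec.fst)
  exact (RatCode.primrecPred_le (RatCode.primrec_add he (h1 hm)) hy').and
    (RatCode.primrecPred_le (RatCode.primrec_add hy' (h1 hm)) (RatCode.primrec_add he (h1 hn)))

theorem primrecPred_nonzeroTest {P : α → Fin d → PolyCode d} {k m : α → ℕ}
    {y : α → CornerCode d} (hP : Primrec P) (hk : Primrec k) (hm : Primrec m) (hy : Primrec y) :
    PrimrecPred fun x => NonzeroTest (P x) (k x) (m x) (y x) := by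
  have hm1 : Primrec fun x => m x + 1 := Primrec.succ.comp hm
  refine PrimrecPred.exists_fin fun i => (RatCode.primrecPred_absLe
    (PolyCode.primrec_eval (hP.apply_fin i) hy) (RatCode.primrec_nat ?_ ?_)).not
  · exact Primrec.nat_add.comp hm1 (Primrec.nat_mul.comp (primrec_two_pow hk)
      (PolyCode.primrec_lip (hP.apply_fin i)))
  · exact Primrec.pred.comp (Primrec.nat_mul.comp (primrec_two_pow hk) hm1)

theorem primrecPred_coverTest {outside : ℕ → CornerCode d → Prop}
    (ho : PrimrecPred fun z : ℕ × CornerCode d => outside z.1 z.2)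
    {P : α → Fin d → PolyCode d} {k m n : α → ℕ} {L : α → List (Cell d)}
    (hP : Primrec P) (hk : Primrec k) (hm : Primrec m) (hn : Primrec n) (hL : Primrec L) :
    PrimrecPred fun x => CoverTest outside (P x) (k x) (m x) (n x) (L x) := by
  have hB : Primrec fun x => 2 * (m x + 1) + 1 :=
    Primrec.nat_double_succ.comp (Primrec.succ.comp hm)
  have hy : Primrec fun z : α × ℕ =>
      meshPoint (d := d) (fun _ => (0, 1, 0)) (m z.1) (2 * (m z.1 + 1) + 1) z.2 :=
    primrec_meshPoint (Primrec.const _) (hm.comp Primrec.fst) (hB.comp Primrec.fst) Primrec.snd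
  exact PrimrecPred.forall_nat_lt (Primrec.nat_pow.comp hB (Primrec.const d))
    ((ho.comp (Primrec.pair (hm.comp Primrec.fst) hy)).or
      ((primrecPred_nonzeroTest (hP.comp Primrec.fst) (hk.comp Primrec.fst)
        (hm.comp Primrec.fst) hy).or
      (primrecPred_interiorTest (hm.comp Primrec.fst) (hn.comp Primrec.fst)
        (hL.comp Primrec.fst) hy)))

theorem primrecPred_separated {n : α → ℕ} {a b : α → CornerCode d} (hn : Primrec n)
    (ha : Primrec a) (hb : Primrec b) : PrimrecPred fun x => Separated (n x) (a x) (b x) := by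
  have h1 : Primrec fun x => ((1, 0, n x) : RatCode) :=
    RatCode.primrec_nat (Primrec.const 1) hn
  exact PrimrecPred.exists_fin fun i =>
    (RatCode.primrecPred_le (hb.apply_fin i) (RatCode.primrec_add (ha.apply_fin i) h1)).not.or
    (RatCode.primrecPred_le (ha.apply_fin i) (RatCode.primrec_add (hb.apply_fin i) h1)).not

theorem primrecPred_accepts {inside outside : ℕ → CornerCode d → Prop}
    (hi : PrimrecPred fun z : ℕ × CornerCode d => inside z.1 z.2)
    (ho : PrimrecPred fun z : ℕ × CornerCode d => outside z.1 z.2)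
    {P : α → Fin d → PolyCode d} {n₀ : α → ℕ} {c : α → Certificate d}
    (hP : Primrec P) (hn₀ : Primrec n₀) (hc : Primrec c) :
    PrimrecPred fun x => Accepts inside outside (P x) (n₀ x) (c x) := by
  have hk : Primrec fun x => (c x).1 := Primrec.fst.comp hc
  have hm : Primrec fun x => (c x).2.1 := Primrec.fst.comp (Primrec.snd.comp hc)
  have hn : Primrec fun x => (c x).2.2.1 :=
    Primrec.fst.comp (Primrec.snd.comp (Primrec.snd.comp hc))
  have hL : Primrec fun x => (c x).2.2.2 :=
    Primrec.snd.comp (Primrec.snd.comp (Primrec.snd.comp hc))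
  refine (Primrec.nat_le.comp hn₀ (Primrec.succ.comp hn)).and (PrimrecPred.and ?_
    (PrimrecPred.and ?_ (primrecPred_coverTest ho hP hk hm hn hL)))
  · exact PrimrecPred.pairwise hL (primrecPred_separated (hn.comp Primrec.fst)
      (Primrec.fst.comp (Primrec.fst.comp Primrec.snd))
      (Primrec.fst.comp (Primrec.snd.comp Primrec.snd)))
  · exact PrimrecPred.forall_mem hL ((hi.comp (Primrec.pair (hn.comp Primrec.fst)
      (Primrec.fst.comp Primrec.snd))).and (primrecPred_newtonTest (hP.comp Primrec.fst)
      (hk.comp Primrec.fst) (hm.comp Primrec.fst) (hn.comp Primrec.fst) Primrec.snd))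

end Primrec

/-- The algorithm: search for a certificate that is accepted, and read off the output. -/
noncomputable def zeroFinder {d : ℕ} (inside outside : ℕ → CornerCode d → Prop) :
    (ℕ → Fin d → PolyCode d) → ℕ →. ℕ × ℕ × List (CornerCode d) :=
  searchFor (fun c : Certificate d => c.1) (Accepts inside outside)
    fun c => (c.2.2.1 + 1, c.2.2.2.length, c.2.2.2.map Prod.fst)

theorem isAlgorithm_zeroFinder {d : ℕ} {inside outside : ℕ → CornerCode d → Prop}
    (hi : PrimrecPred fun z : ℕ × CornerCode d => inside z.1 z.2)
    (ho : PrimrecPred fun z : ℕ × CornerCode d => outside z.1 z.2) :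
    IsAlgorithm (zeroFinder inside outside) := by
  refine isAlgorithm_searchFor Primrec.fst (primrecPred_accepts hi ho Primrec.fst
    (Primrec.fst.comp Primrec.snd) (Primrec.snd.comp Primrec.snd)) ?_
  have h3 : Primrec fun c : Certificate d => c.2.2 := Primrec.snd.comp Primrec.snd
  exact Primrec.pair (Primrec.succ.comp (Primrec.fst.comp h3)) (Primrec.pair
    (Primrec.list_length.comp (Primrec.snd.comp h3))
    (Primrec.list_map (Primrec.snd.comp h3) (Primrec.fst.comp Primrec.snd)))

/-! ### The Newton-like map -/

theorem norm_image_sub_le_of_abs_entries_le {d : ℕ} {s : Set (Fin d → ℝ)} (hs : Convex ℝ s)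
    {g : (Fin d → ℝ) → (Fin d → ℝ)} {g' : (Fin d → ℝ) → (Fin d → ℝ) →L[ℝ] (Fin d → ℝ)} {c : ℝ}
    (hg : ∀ y ∈ s, HasFDerivAt g (g' y) y) (hc : 0 ≤ c)
    (h : ∀ y ∈ s, ∀ i l, |g' y (Pi.single l 1) i| ≤ c) {x y : Fin d → ℝ} (hx : x ∈ s)
    (hy : y ∈ s) : ‖g x - g y‖ ≤ d * c * ‖x - y‖ := by
  refine hs.norm_image_sub_le_of_norm_hasFDerivWithin_le
    (fun z hz => (hg z hz).hasFDerivWithinAt) (fun z hz => ?_) hy hx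
  refine ContinuousLinearMap.opNorm_le_bound _ (by positivity) fun v => ?_
  refine (pi_norm_le_iff_of_nonneg (by positivity)).2 fun i => ?_
  have hv : v = ∑ l, v l • (Pi.single l (1 : ℝ) : Fin d → ℝ) := by
    ext i
    simp [Finset.sum_apply, Pi.single_apply]
  calc ‖g' z v i‖ = |∑ l, v l * g' z (Pi.single l 1) i| := by
        conv_lhs => rw [hv, map_sum, Finset.sum_apply]
        simp [Real.norm_eq_abs]
    _ ≤ ∑ l, |v l * g' z (Pi.single l 1) i| := Finset.abs_sum_le_sum_abs _ _
    _ ≤ ∑ _l : Fin d, ‖v‖ * c := by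
        refine Finset.sum_le_sum fun l _ => ?_
        rw [abs_mul]
        exact mul_le_mul (norm_le_pi_norm v l) (h z hz i l) (abs_nonneg _) (norm_nonneg _)
    _ = d * c * ‖v‖ := by simp; ring

/-- The map `y ↦ y - A f(y)`. -/
def newtonMap {d : ℕ} (A : Matrix (Fin d) (Fin d) ℝ) (f : (Fin d → ℝ) → (Fin d → ℝ))
    (y : Fin d → ℝ) : Fin d → ℝ := y - A.mulVec (f y)

/-- The entry in row `i` and column `l` of `1 - A * Df`, where the linear map `T` is `Df`. -/
def newtonDefect {d : ℕ} (A : Matrix (Fin d) (Fin d) ℝ) (T : (Fin d → ℝ) →L[ℝ] (Fin d → ℝ))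
    (i l : Fin d) : ℝ := (if i = l then 1 else 0) - ∑ j, A i j * T (Pi.single l 1) j

section Newton

variable {d : ℕ} {A : Matrix (Fin d) (Fin d) ℝ} {f : (Fin d → ℝ) → (Fin d → ℝ)}
  {f' : (Fin d → ℝ) → (Fin d → ℝ) →L[ℝ] (Fin d → ℝ)} {s : Set (Fin d → ℝ)}

theorem norm_newtonMap_sub_le (hd : 1 ≤ d) (hs : Convex ℝ s)
    (hf : ∀ y ∈ s, HasFDerivAt f (f' y) y)
    (hJ : ∀ y ∈ s, ∀ i l, |newtonDefect A (f' y) i l| ≤ 1 / (4 * d)) {x y : Fin d → ℝ} (hx : x ∈ s)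
    (hy : y ∈ s) : ‖newtonMap A f x - newtonMap A f y‖ ≤ 1 / 4 * ‖x - y‖ := by
  have hd' : (0 : ℝ) < d := by exact_mod_cast hd
  have h := norm_image_sub_le_of_abs_entries_le hs (g := newtonMap A f)
    (g' := fun y => ContinuousLinearMap.id ℝ _ -
      (LinearMap.toContinuousLinearMap A.mulVecLin).comp (f' y)) (c := 1 / (4 * d))
    (fun y hy => (hasFDerivAt_id y).sub
      ((LinearMap.toContinuousLinearMap A.mulVecLin).hasFDerivAt.comp y (hf y hy)))
    (by positivity) (fun y hy i l => ?_) hx hy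
  · calc _ ≤ _ := h
      _ = _ := by field_simp
  · refine le_trans (le_of_eq ?_) (hJ y hy i l)
    simp [newtonDefect, Matrix.mulVec, dotProduct, Pi.single_apply]

theorem eq_of_newton (hd : 1 ≤ d) (hs : Convex ℝ s) (hf : ∀ y ∈ s, HasFDerivAt f (f' y) y)
    (hJ : ∀ y ∈ s, ∀ i l, |newtonDefect A (f' y) i l| ≤ 1 / (4 * d)) {x y : Fin d → ℝ} (hx : x ∈ s)
    (hy : y ∈ s) (hfx : f x = 0) (hfy : f y = 0) : x = y := by
  have h := norm_newtonMap_sub_le hd hs hf hJ hx hy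
  simp only [newtonMap, hfx, hfy, Matrix.mulVec_zero, sub_zero] at h
  have : ‖x - y‖ = 0 := by linarith [norm_nonneg (x - y)]
  exact sub_eq_zero.1 (norm_eq_zero.1 this)

/-- A matrix `A` such that `1 - A T` is small is injective, so that the fixed points of the
Newton-like map are zeros. -/
theorem eq_zero_of_mulVec_eq_zero_of_newtonDefect (hd : 1 ≤ d) {T : (Fin d → ℝ) →L[ℝ] (Fin d → ℝ)}
    (h : ∀ i l, |newtonDefect A T i l| ≤ 1 / (4 * d)) {w : Fin d → ℝ} (hw : A.mulVec w = 0) :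
    w = 0 := by
  have hc (u v : Fin d → ℝ) := norm_newtonMap_sub_le (A := A) (f := T) (f' := fun _ => T) hd
    convex_univ (fun y _ => T.hasFDerivAt) (fun _ _ => h) (Set.mem_univ u) (Set.mem_univ v)
  have hT : Function.Injective T.toLinearMap := by
    refine (injective_iff_map_eq_zero _).2 fun v hv => ?_
    exact eq_of_newton (A := A) (f := T) (f' := fun _ => T) hd convex_univ
      (fun y _ => T.hasFDerivAt) (fun _ _ => h) (Set.mem_univ v) (Set.mem_univ 0) hv (map_zero T)
  obtain ⟨v, rfl⟩ := LinearMap.injective_iff_surjective.1 hT w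
  have := hc v 0
  simp only [newtonMap, map_zero, Matrix.mulVec_zero, sub_zero] at this
  have hw' : A.mulVec (T v) = 0 := hw
  rw [hw', sub_zero] at this
  have hv : ‖v‖ = 0 := by linarith [norm_nonneg v]
  simp [norm_eq_zero.1 hv]

theorem existsUnique_zero_of_newton (hd : 1 ≤ d) {c : Fin d → ℝ} {r : ℝ} (hr : 0 ≤ r)
    (hf : ∀ y ∈ Metric.closedBall c r, HasFDerivAt f (f' y) y)
    (hJ : ∀ y ∈ Metric.closedBall c r, ∀ i l, |newtonDefect A (f' y) i l| ≤ 1 / (4 * d))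
    (hc : ∀ i, |∑ j, A i j * f c j| ≤ r / 2) :
    ∃! x, x ∈ Metric.closedBall c r ∧ f x = 0 := by
  have hcc : c ∈ Metric.closedBall c r := Metric.mem_closedBall_self hr
  have hlip {x y : Fin d → ℝ} (hx : x ∈ Metric.closedBall c r) (hy : y ∈ Metric.closedBall c r) :=
    norm_newtonMap_sub_le hd (convex_closedBall c r) hf hJ hx hy
  have hc' : ‖newtonMap A f c - c‖ ≤ r / 2 := by
    refine (pi_norm_le_iff_of_nonneg (by positivity)).2 fun i => ?_
    simpa [newtonMap, Matrix.mulVec, dotProduct] using hc i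
  have hmaps : Set.MapsTo (newtonMap A f) (Metric.closedBall c r) (Metric.closedBall c r) := by
    intro y hy
    rw [mem_closedBall_iff_norm]
    have h1 := hlip hy hcc
    have h2 := mem_closedBall_iff_norm.1 hy
    calc ‖newtonMap A f y - c‖ ≤ ‖newtonMap A f y - newtonMap A f c‖ + ‖newtonMap A f c - c‖ :=
          norm_sub_le_norm_sub_add_norm_sub _ _ _
      _ ≤ r := by linarith
  have hcontr : ContractingWith (1 / 4) hmaps.restrict := by
    refine ⟨by norm_num [← NNReal.coe_lt_coe], LipschitzWith.of_dist_le_mul fun x y => ?_⟩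
    simpa [Subtype.dist_eq, dist_eq_norm] using hlip x.2 y.2
  obtain ⟨x, hx, hfix, -⟩ := hcontr.exists_fixedPoint' Metric.isClosed_closedBall.isComplete hmaps
    hcc (edist_ne_top _ _)
  refine ⟨x, ⟨hx, ?_⟩, fun y hy => eq_of_newton hd (convex_closedBall c r) hf hJ hy.1 hx hy.2 ?_⟩
  all_goals
    refine eq_zero_of_mulVec_eq_zero_of_newtonDefect hd (hJ x hx) ?_
    have : x - A.mulVec (f x) = x := hfix
    simpa using this

end Newton

/-! ### The tests in terms of real numbers -/

theorem RatCode.le_iff_real (p q : RatCode) : Le p q ↔ (p.toRat : ℝ) ≤ q.toRat := by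
  rw [le_iff, Rat.cast_le]

theorem RatCode.absLe_iff_real (p q : RatCode) : AbsLe p q ↔ |(p.toRat : ℝ)| ≤ q.toRat := by
  rw [absLe_iff, ← Rat.cast_abs, Rat.cast_le]

theorem RatCode.cast_toRat_natCast (n m : ℕ) :
    ((toRat (n, 0, m) : ℚ) : ℝ) = n / ((m : ℝ) + 1) := by
  rw [toRat_natCast]; push_cast; rfl

theorem toReal_meshPoint {d : ℕ} (a : CornerCode d) (s B t : ℕ) (i : Fin d) :
    (meshPoint a s B t).toReal i = a.toReal i + (t / B ^ (i : ℕ) % B : ℕ) / ((s : ℝ) + 1) := by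
  rw [CornerCode.toReal, meshPoint, RatCode.toRat_add, Rat.cast_add, RatCode.cast_toRat_natCast]
  rfl

theorem toReal_cubeCenter {d : ℕ} (n : ℕ) (a : CornerCode d) (i : Fin d) :
    (cubeCenter n a).toReal i = a.toReal i + 1 / (2 * ((n : ℝ) + 1)) := by
  rw [CornerCode.toReal, cubeCenter, RatCode.toRat_add, Rat.cast_add, RatCode.cast_toRat_natCast]
  congr 1
  push_cast
  ring_nf

theorem meshPoint_mem {d : ℕ} (a : CornerCode d) (s B t : ℕ) (i : Fin d) :
    a.toReal i ≤ (meshPoint a s (B + 1) t).toReal i ∧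
      (meshPoint a s (B + 1) t).toReal i ≤ a.toReal i + B / ((s : ℝ) + 1) := by
  rw [toReal_meshPoint]
  have h : t / (B + 1) ^ (i : ℕ) % (B + 1) ≤ B := Nat.lt_succ_iff.1 (Nat.mod_lt _ (by omega))
  constructor
  · have : (0 : ℝ) ≤ (t / (B + 1) ^ (i : ℕ) % (B + 1) : ℕ) / ((s : ℝ) + 1) := by positivity
    linarith
  · gcongr

theorem exists_meshPoint_near {d : ℕ} (a : CornerCode d) (s B : ℕ) {y : Fin d → ℝ}
    (hy : ∀ i, a.toReal i ≤ y i ∧ y i ≤ a.toReal i + B / ((s : ℝ) + 1)) :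
    ∃ t < (B + 1) ^ d, ∀ i, |y i - (meshPoint a s (B + 1) t).toReal i| ≤ 1 / ((s : ℝ) + 1) := by
  have hs : (0 : ℝ) < (s : ℝ) + 1 := by positivity
  have h0 (i : Fin d) : 0 ≤ (y i - a.toReal i) * ((s : ℝ) + 1) :=
    mul_nonneg (sub_nonneg.2 (hy i).1) hs.le
  let u : Fin d → Fin (B + 1) := fun i => ⟨⌊(y i - a.toReal i) * ((s : ℝ) + 1)⌋₊, by
    rw [Nat.lt_succ_iff]
    refine Nat.floor_le_of_le ?_
    rw [← le_div_iff₀ hs]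
    linarith [(hy i).2]⟩
  refine ⟨finFunctionFinEquiv u, (finFunctionFinEquiv u).2, fun i => ?_⟩
  have hu : (finFunctionFinEquiv u : ℕ) / (B + 1) ^ (i : ℕ) % (B + 1) =
      ⌊(y i - a.toReal i) * ((s : ℝ) + 1)⌋₊ :=
    congrArg Fin.val (congrFun (finFunctionFinEquiv.symm_apply_apply u) i)
  rw [toReal_meshPoint, hu]
  have h1 := Nat.floor_le (h0 i)
  have h2 := Nat.lt_floor_add_one ((y i - a.toReal i) * ((s : ℝ) + 1))
  have h3 : y i - (a.toReal i + (⌊(y i - a.toReal i) * ((s : ℝ) + 1)⌋₊ : ℕ) / ((s : ℝ) + 1)) =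
      ((y i - a.toReal i) * ((s : ℝ) + 1) - (⌊(y i - a.toReal i) * ((s : ℝ) + 1)⌋₊ : ℕ)) /
        ((s : ℝ) + 1) := by
    field_simp; ring
  rw [h3, abs_of_nonneg (div_nonneg (by linarith) hs.le)]
  gcongr
  linarith

theorem hypercube_eq_closedBall {d : ℕ} (n : ℕ) (a : CornerCode d) :
    hypercube (n + 1) a =
      Metric.closedBall (cubeCenter n a).toReal (1 / (2 * ((n : ℝ) + 1))) := by
  ext x
  rw [mem_hypercube_iff, mem_closedBall_iff_norm,
    pi_norm_le_iff_of_nonneg (by positivity)]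
  refine forall_congr' fun i => ?_
  rw [Pi.sub_apply, toReal_cubeCenter, Real.norm_eq_abs, abs_le]
  have : 1 / ((n : ℝ) + 1) = 1 / (2 * ((n : ℝ) + 1)) + 1 / (2 * ((n : ℝ) + 1)) := by
    field_simp; norm_num
  rw [this]
  constructor <;> rintro ⟨h1, h2⟩ <;> constructor <;> linarith

theorem interiorTest_iff {d m n : ℕ} {L : List (Cell d)} {x : CornerCode d} :
    InteriorTest m n L x ↔ ∃ e ∈ L, ∀ i, e.1.toReal i + 1 / ((m : ℝ) + 1) ≤ x.toReal i ∧
      x.toReal i + 1 / ((m : ℝ) + 1) ≤ e.1.toReal i + 1 / ((n : ℝ) + 1) := by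
  simp only [InteriorTest, RatCode.le_iff_real, RatCode.toRat_add, Rat.cast_add,
    RatCode.cast_toRat_natCast, CornerCode.toReal, Nat.cast_one]

theorem nonzeroTest_iff {d : ℕ} {P : Fin d → PolyCode d} {k m : ℕ} {x : CornerCode d} :
    NonzeroTest P k m x ↔
      ∃ i, 1 / 2 ^ k + (P i).lip * (1 / ((m : ℝ) + 1)) < |(P i).fn x.toReal| := by
  refine exists_congr fun i => ?_
  have h : ((2 ^ k * (m + 1) - 1 : ℕ) : ℝ) + 1 = 2 ^ k * (m + 1) := by
    exact_mod_cast Nat.sub_add_cancel (Nat.one_le_iff_ne_zero.2 (by positivity))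
  rw [RatCode.absLe_iff_real, PolyCode.toRat_eval, not_le, RatCode.cast_toRat_natCast, h]
  have : ((m + 1 + 2 ^ k * (P i).lip : ℕ) : ℝ) / (2 ^ k * (m + 1)) =
      1 / 2 ^ k + (P i).lip * (1 / ((m : ℝ) + 1)) := by
    push_cast; field_simp
  rw [this]

theorem separated_iff {d n : ℕ} {a b : CornerCode d} :
    Separated n a b ↔ ∃ i, a.toReal i + 1 / ((n : ℝ) + 1) < b.toReal i ∨
      b.toReal i + 1 / ((n : ℝ) + 1) < a.toReal i := by
  simp only [Separated, RatCode.le_iff_real, RatCode.toRat_add, Rat.cast_add,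
    RatCode.cast_toRat_natCast, CornerCode.toReal, Nat.cast_one, not_le]

/-- The real matrix with the given codes. -/
noncomputable def toRealMatrix {d : ℕ} (A : Fin d → Fin d → RatCode) :
    Matrix (Fin d) (Fin d) ℝ := .of fun i j => ((A i j).toRat : ℝ)

theorem toRat_newtonDefectCode {d : ℕ} (P : Fin d → PolyCode d) (A : Fin d → Fin d → RatCode)
    (x : CornerCode d) (i l : Fin d) :
    ((newtonDefectCode P A x i l).toRat : ℝ) = (if i = l then 1 else 0) -
      ∑ j, toRealMatrix A i j * ((P j).deriv l).fn x.toReal := by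
  rw [newtonDefectCode, RatCode.toRat_add, RatCode.toRat_neg, RatCode.toRat_sum, sub_eq_add_neg]
  push_cast
  congr 1
  · split_ifs <;> simp [RatCode.toRat]
  · simp [RatCode.toRat_mul, PolyCode.toRat_eval, toRealMatrix]

theorem newtonTest_iff {d : ℕ} (hd : 1 ≤ d) {P : Fin d → PolyCode d} {k m n : ℕ} {e : Cell d} :
    NewtonTest P k m n e ↔
      (∀ i, |∑ j, toRealMatrix e.2 i j * (P j).fn (cubeCenter n e.1).toReal| ≤
        1 / (8 * ((n : ℝ) + 1))) ∧
      (∀ i j, (e.2 i j).bound * (1 / 2 ^ k) ≤ 1 / (8 * ((n : ℝ) + 1) * d)) ∧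
      (∀ i j l, (e.2 i j).bound * (1 / 2 ^ k + ((P j).deriv l).lip * (1 / ((m : ℝ) + 1))) ≤
        1 / (8 * (d : ℝ) ^ 2)) ∧
      ∀ t < (m + 2) ^ d, ∀ i l, |(if i = l then 1 else 0) - ∑ j, toRealMatrix e.2 i j *
        ((P j).deriv l).fn (meshPoint e.1 ((n + 1) * (m + 1) - 1) (m + 2) t).toReal| ≤
          1 / (8 * (d : ℝ)) := by
  have hd' : (0 : ℝ) < d := by exact_mod_cast hd
  refine and_congr ?_ (and_congr ?_ (and_congr ?_ ?_))
  · refine forall_congr' fun i => ?_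
    rw [RatCode.absLe_iff_real, RatCode.cast_toRat_natCast, RatCode.toRat_sum]
    have h : ((8 * n + 7 : ℕ) : ℝ) + 1 = 8 * ((n : ℝ) + 1) := by push_cast; ring
    rw [h]
    simp [RatCode.toRat_mul, PolyCode.toRat_eval, toRealMatrix]
  · refine forall₂_congr fun i j => ?_
    rw [← mul_div_assoc, mul_one, div_le_div_iff₀ (by positivity) (by positivity),
      ← Nat.cast_le (α := ℝ)]
    push_cast
    rw [mul_comm ((e.2 i j).bound : ℝ), one_mul]
  · refine forall₃_congr fun i j l => ?_
    have h : ((e.2 i j).bound : ℝ) * (1 / 2 ^ k + ((P j).deriv l).lip * (1 / ((m : ℝ) + 1))) =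
        (e.2 i j).bound * (m + 1 + 2 ^ k * ((P j).deriv l).lip) / (2 ^ k * (m + 1)) := by
      field_simp
    rw [h, div_le_div_iff₀ (by positivity) (by positivity), ← Nat.cast_le (α := ℝ)]
    push_cast
    rw [one_mul, mul_comm _ (8 * (d : ℝ) ^ 2), ← mul_assoc]
  · refine forall₂_congr fun t _ => forall₂_congr fun i l => ?_
    have h : ((8 * d - 1 : ℕ) : ℝ) + 1 = 8 * (d : ℝ) := by
      exact_mod_cast Nat.sub_add_cancel (by omega : 1 ≤ 8 * d)
    rw [RatCode.absLe_iff_real, RatCode.cast_toRat_natCast, h, toRat_newtonDefectCode, Nat.cast_one]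

/-! ### Soundness of the tests -/

/-- The polynomials `p` approximate `f` on `K` with error at most `ε`, and so do their partial
derivatives. -/
def IsC1Approx {d : ℕ} (K : Set (Fin d → ℝ)) (f : (Fin d → ℝ) → (Fin d → ℝ))
    (p : Fin d → PolyCode d) (ε : ℝ) : Prop :=
  ∀ y ∈ K, ∀ i, |f y i - (p i).fn y| ≤ ε ∧
    ∀ l, |fderiv ℝ f y (Pi.single l 1) i - ((p i).deriv l).fn y| ≤ ε

theorem IsC1On.hasFDerivAt {d : ℕ} {K : Set (Fin d → ℝ)} {f : (Fin d → ℝ) → (Fin d → ℝ)}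
    (hf : IsC1On K f) {y : Fin d → ℝ} (hy : y ∈ K) : HasFDerivAt f (fderiv ℝ f y) y := by
  obtain ⟨U, hU, hKU, h⟩ := hf
  exact ((h.contDiffAt (hU.mem_nhds (hKU hy))).differentiableAt one_ne_zero).hasFDerivAt

theorem IsC1Name.isC1Approx {d : ℕ} {K : Set (Fin d → ℝ)} {f : (Fin d → ℝ) → (Fin d → ℝ)}
    {P : ℕ → Fin d → PolyCode d} (hf : IsC1On K f) (hP : IsC1Name K f P) (k : ℕ) :
    IsC1Approx K f (P k) (1 / 2 ^ k) := by
  intro y hy i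
  have key {E : Type} [NormedAddCommGroup E] {v : E} (h : ‖v‖ₑ < (2⁻¹ : ℝ≥0∞) ^ k) :
      ‖v‖ ≤ 1 / 2 ^ k := by
    have := ENNReal.toReal_mono (by finiteness) h.le
    simpa using this
  have h := hP k i
  rw [c1Norm] at h
  constructor
  · have h1 := (le_biSup (fun x => ‖f x i - MvPolynomial.aeval x (P k i).toPoly‖ₑ) hy).trans_lt
      (le_self_add.trans_lt h)
    exact key h1
  · intro l
    have h2 := key ((le_biSup (fun x => ‖fderiv ℝ
      (fun x => f x i - MvPolynomial.aeval x (P k i).toPoly) x‖ₑ) hy).trans_lt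
      (le_add_self.trans_lt h))
    have h3 : HasFDerivAt (fun x => f x i - (P k i).fn x)
        ((ContinuousLinearMap.proj (R := ℝ) (φ := fun _ => ℝ) i).comp (fderiv ℝ f y) -
          fderiv ℝ (P k i).fn y) y :=
      (hasFDerivAt_pi'.1 (hf.hasFDerivAt hy) i).sub
        ((P k i).hasFDerivAt_fn y).differentiableAt.hasFDerivAt
    have h4 := (fderiv ℝ (fun x => f x i - (P k i).fn x) y).le_opNorm (Pi.single l 1)
    have h5 : ‖(Pi.single l 1 : Fin d → ℝ)‖ = 1 := by simp [Pi.norm_single]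
    rw [h5, mul_one, Real.norm_eq_abs] at h4
    refine le_trans (le_of_eq ?_) (h4.trans h2)
    rw [h3.fderiv, sub_apply, PolyCode.fderiv_fn_single]
    rfl

theorem abs_toRealMatrix_le {d : ℕ} (A : Fin d → Fin d → RatCode) (i j : Fin d) :
    |toRealMatrix A i j| ≤ (A i j).bound := by
  have := (A i j).abs_toRat_le_bound
  rw [← Rat.cast_le (K := ℝ), Rat.cast_abs] at this
  simpa [toRealMatrix] using this

theorem abs_sum_mul_sub_sum_mul_le {d : ℕ} (hd : 1 ≤ d) {a u v b w : Fin d → ℝ} {c : ℝ}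
    (ha : ∀ j, |a j| ≤ b j) (huv : ∀ j, |u j - v j| ≤ w j) (hc : ∀ j, b j * w j ≤ c / d) :
    |∑ j, a j * u j - ∑ j, a j * v j| ≤ c := by
  have hd' : (0 : ℝ) < d := by exact_mod_cast hd
  rw [← Finset.sum_sub_distrib]
  calc _ ≤ ∑ j, |a j * u j - a j * v j| := Finset.abs_sum_le_sum_abs _ _
    _ ≤ ∑ _j : Fin d, c / d := by
        refine Finset.sum_le_sum fun j _ => ?_
        rw [← mul_sub, abs_mul]
        exact (mul_le_mul (ha j) (huv j) (abs_nonneg _) ((abs_nonneg _).trans (ha j))).trans (hc j)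
    _ = c := by
        rw [Finset.sum_const, Finset.card_univ, Fintype.card_fin, nsmul_eq_mul]
        field_simp

section Soundness

variable {d : ℕ} {K : Set (Fin d → ℝ)} {f : (Fin d → ℝ) → (Fin d → ℝ)}
  {inside outside : ℕ → CornerCode d → Prop} {P : Fin d → PolyCode d} {k m n : ℕ}

/-- The test carries over from `P` to `f`: an arbitrary point of the cube is compared with a nearby
mesh point, through the Lipschitz constants of the derivatives of `P`. -/
theorem NewtonTest.existsUnique (hd : 1 ≤ d) (hK : ∀ x ∈ K, ∀ i, |x i| ≤ 1) (hf : IsC1On K f)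
    (hP : IsC1Approx K f P (1 / 2 ^ k)) {e : Cell d} (he : hypercube (n + 1) e.1 ⊆ K)
    (h : NewtonTest P k m n e) : ∃! x, x ∈ hypercube (n + 1) e.1 ∧ x ∈ zeroSet K f := by
  have hd' : (0 : ℝ) < d := by exact_mod_cast hd
  obtain ⟨h1, h2, h3, h4⟩ := (newtonTest_iff hd).1 h
  have hr : (0 : ℝ) ≤ 1 / (2 * ((n : ℝ) + 1)) := by positivity
  have hsub := he
  rw [hypercube_eq_closedBall] at hsub
  have huniq := existsUnique_zero_of_newton (A := toRealMatrix e.2) (f := f) (f' := fderiv ℝ f) hd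
    (c := (cubeCenter n e.1).toReal) hr (fun y hy => hf.hasFDerivAt (hsub hy)) ?_ ?_
  · rw [← hypercube_eq_closedBall] at huniq
    refine (existsUnique_congr fun x => ?_).1 huniq
    exact and_congr_right fun hx => ⟨fun h => ⟨he hx, h⟩, fun h => h.2⟩
  · intro y hy i l
    have hyK := hsub hy
    rw [← hypercube_eq_closedBall, mem_hypercube_iff] at hy
    have hs : (((n + 1) * (m + 1) - 1 : ℕ) : ℝ) + 1 = ((n : ℝ) + 1) * (m + 1) := by
      exact_mod_cast Nat.sub_add_cancel (Nat.one_le_iff_ne_zero.2 (by positivity))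
    have hedge : ((m + 1 : ℕ) : ℝ) / ((((n + 1) * (m + 1) - 1 : ℕ) : ℝ) + 1) =
        1 / ((n : ℝ) + 1) := by
      rw [hs]; push_cast; field_simp
    obtain ⟨t, ht, hty⟩ := exists_meshPoint_near e.1 ((n + 1) * (m + 1) - 1) (m + 1) (y := y)
      (by rw [hedge]; exact hy)
    set x := meshPoint e.1 ((n + 1) * (m + 1) - 1) (m + 2) t with hx
    have hxK : x.toReal ∈ K := he (mem_hypercube_iff.2 (by
      have := meshPoint_mem e.1 ((n + 1) * (m + 1) - 1) (m + 1) t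
      rw [hedge] at this; exact this))
    have hyx : ‖y - x.toReal‖ ≤ 1 / ((m : ℝ) + 1) := by
      refine (pi_norm_le_iff_of_nonneg (by positivity)).2 fun i => (hty i).trans ?_
      rw [hs]
      apply one_div_le_one_div_of_le (by positivity)
      nlinarith [n.cast_nonneg (α := ℝ), m.cast_nonneg (α := ℝ)]
    have herr := abs_sum_mul_sub_sum_mul_le hd (a := toRealMatrix e.2 i)
      (u := fun j => ((P j).deriv l).fn x.toReal) (v := fun j => fderiv ℝ f y (Pi.single l 1) j)
      (w := fun j => 1 / 2 ^ k + ((P j).deriv l).lip * (1 / ((m : ℝ) + 1))) (c := 1 / (8 * d))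
      (abs_toRealMatrix_le e.2 i) (fun j => ?_) (fun j => ?_)
    · have h4' := h4 t ht i l
      rw [newtonDefect]
      have : (if i = l then 1 else 0) - ∑ j, toRealMatrix e.2 i j *
          fderiv ℝ f y (Pi.single l 1) j = ((if i = l then 1 else 0) - ∑ j, toRealMatrix e.2 i j *
          ((P j).deriv l).fn x.toReal) + (∑ j, toRealMatrix e.2 i j *
          ((P j).deriv l).fn x.toReal - ∑ j, toRealMatrix e.2 i j *
          fderiv ℝ f y (Pi.single l 1) j) := by ring
      rw [this]
      calc _ ≤ 1 / (8 * (d : ℝ)) + 1 / (8 * d) := (abs_add_le _ _).trans (add_le_add h4' herr)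
        _ = 1 / (4 * d) := by field_simp; norm_num
    · have e1 := (hP y hyK j).2 l
      have e2 := ((P j).deriv l).abs_fn_sub_le (hK _ hyK) (hK _ hxK)
      have e3 : (((P j).deriv l).lip : ℝ) * ‖y - x.toReal‖ ≤
          ((P j).deriv l).lip * (1 / ((m : ℝ) + 1)) := by gcongr
      rw [abs_sub_comm]
      exact (abs_sub_le _ (((P j).deriv l).fn y) _).trans
        (add_le_add e1 (e2.trans e3))
    · refine (h3 i j l).trans (le_of_eq ?_)
      field_simp
  · intro i
    have hcK := hsub (Metric.mem_closedBall_self hr)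
    have herr := abs_sum_mul_sub_sum_mul_le hd (a := toRealMatrix e.2 i)
      (u := f (cubeCenter n e.1).toReal) (v := fun j => (P j).fn (cubeCenter n e.1).toReal)
      (w := fun _ => 1 / 2 ^ k) (c := 1 / (8 * ((n : ℝ) + 1)))
      (abs_toRealMatrix_le e.2 i) (fun j => (hP _ hcK j).1) (fun j => ?_)
    · have := abs_add_le _ _ |>.trans (add_le_add herr (h1 i))
      rw [sub_add_cancel] at this
      refine this.trans (le_of_eq ?_)
      field_simp; norm_num
    · refine (h2 i j).trans (le_of_eq ?_)
      field_simp

/-- A zero has a mesh point nearby, and there neither of the first two alternatives of the test can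
hold. -/
theorem CoverTest.subset (T : BallTests K inside outside) (hP : IsC1Approx K f P (1 / 2 ^ k))
    {L : List (Cell d)} (h : CoverTest outside P k m n L) {y : Fin d → ℝ} (hy : y ∈ zeroSet K f) :
    ∃ e ∈ L, y ∈ hypercube (n + 1) e.1 := by
  have ha : CornerCode.toReal (d := d) (fun _ => (0, 1, 0)) = fun _ => -1 := by
    funext i; simp [CornerCode.toReal, RatCode.toRat]
  have hedge : (-1 : ℝ) + ((2 * (m + 1) : ℕ) : ℝ) / ((m : ℝ) + 1) = 1 := by
    push_cast; field_simp; norm_num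
  obtain ⟨t, ht, hty⟩ := exists_meshPoint_near (fun _ => (0, 1, 0)) m (2 * (m + 1)) (y := y)
    (fun i => by rw [ha, hedge]; exact abs_le.1 (T.abs_le y hy.1 i))
  have hx1 := meshPoint_mem (d := d) (fun _ => (0, 1, 0)) m (2 * (m + 1)) t
  rw [ha] at hx1
  simp only [hedge] at hx1
  rcases h t ht with h | h | h
  · exact (T.outside_sound _ _ h y hy.1 hty).elim
  · obtain ⟨i, hi⟩ := nonzeroTest_iff.1 h
    have e1 := (hP y hy.1 i).1
    have e2 := (P i).abs_fn_sub_le (T.abs_le y hy.1) (fun i => abs_le.2 (hx1 i))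
    have e3 : ‖y - (meshPoint (fun _ => (0, 1, 0)) m (2 * (m + 1) + 1) t).toReal‖ ≤
        1 / ((m : ℝ) + 1) := (pi_norm_le_iff_of_nonneg (by positivity)).2 hty
    have e4 := mul_le_mul_of_nonneg_left e3 ((P i).lip.cast_nonneg (α := ℝ))
    rw [hy.2, Pi.zero_apply, zero_sub, abs_neg] at e1
    have e5 := abs_sub_abs_le_abs_sub ((P i).fn
      (meshPoint (fun _ => (0, 1, 0)) m (2 * (m + 1) + 1) t).toReal) ((P i).fn y)
    rw [abs_sub_comm] at e5
    refine absurd hi (not_lt.2 ?_)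
    calc _ ≤ _ := sub_le_iff_le_add'.1 (e5.trans e2)
      _ ≤ _ := add_le_add e1 e4
  · obtain ⟨e, he, hx⟩ := interiorTest_iff.1 h
    refine ⟨e, he, mem_hypercube_iff.2 fun i => ?_⟩
    have := abs_le.1 (hty i)
    exact ⟨by linarith [(hx i).1], by linarith [(hx i).2]⟩

theorem Separated.disjoint {a b : CornerCode d} (h : Separated n a b) {x y : Fin d → ℝ}
    (hx : x ∈ hypercube (n + 1) a) (hy : y ∈ hypercube (n + 1) b) : x ≠ y := by
  rintro rfl
  obtain ⟨i, h⟩ := separated_iff.1 h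
  have h1 := mem_hypercube_iff.1 hx i
  have h2 := mem_hypercube_iff.1 hy i
  rcases h with h | h <;> linarith [h1.1, h1.2, h2.1, h2.2]

/-- The zeros in pairwise disjoint cubes are counted by the cubes. -/
theorem encard_zeroSet_eq_length {Z : Set (Fin d → ℝ)} {L : List (Cell d)}
    (hsep : L.Pairwise fun e e' => Separated n e.1 e'.1)
    (hex : ∀ e ∈ L, ∃! x, x ∈ hypercube (n + 1) e.1 ∧ x ∈ Z)
    (hcov : ∀ y ∈ Z, ∃ e ∈ L, y ∈ hypercube (n + 1) e.1) : Z.encard = L.length := by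
  choose! z hz hz' using fun e he => hex e he
  let g : Fin L.length → (Fin d → ℝ) := fun i => z L[i]
  have hg (i : Fin L.length) : g i ∈ hypercube (n + 1) L[i].1 ∧ g i ∈ Z :=
    hz _ (List.getElem_mem _)
  have hinj : Function.Injective g := by
    have hlt (i j : Fin L.length) (hij : i < j) : g i ≠ g j :=
      (List.pairwise_iff_getElem.1 hsep i j i.2 j.2 hij).disjoint (hg i).1 (hg j).1
    intro i j hij
    rcases lt_trichotomy i j with h | h | h
    · exact (hlt i j h hij).elim
    · exact h
    · exact (hlt j i h hij.symm).elim
  have hrange : Set.range g = Z := by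
    refine subset_antisymm (Set.range_subset_iff.2 fun i => (hg i).2) fun y hy => ?_
    obtain ⟨e, he, hye⟩ := hcov y hy
    obtain ⟨i, hi, rfl⟩ := List.getElem_of_mem he
    exact ⟨⟨i, hi⟩, (hz' _ he y ⟨hye, hy⟩).symm⟩
  rw [← hrange, ← Set.image_univ, hinj.encard_image, Set.encard_univ]
  simp

theorem hausdorffEDist_iUnion_hypercube_le {Z : Set (Fin d → ℝ)} {C : List (CornerCode d)}
    (hC : ∀ a ∈ C, ∃ x, x ∈ hypercube (n + 1) a ∧ x ∈ Z)
    (hZ : Z ⊆ ⋃ a ∈ C, hypercube (n + 1) a) :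
    Metric.hausdorffEDist Z (⋃ a ∈ C, hypercube (n + 1) a) ≤
      ENNReal.ofReal (1 / ((n + 1 : ℕ) : ℝ)) := by
  refine Metric.hausdorffEDist_le_of_mem_edist (fun x hx => ⟨x, hZ hx, by simp⟩) fun y hy => ?_
  simp only [Set.mem_iUnion] at hy
  obtain ⟨a, ha, hy⟩ := hy
  obtain ⟨x, hx, hxZ⟩ := hC a ha
  refine ⟨x, hxZ, ?_⟩
  rw [edist_dist]
  refine ENNReal.ofReal_le_ofReal ((dist_pi_le_iff (by positivity)).2 fun i => ?_)
  have h1 := mem_hypercube_iff.1 hx i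
  have h2 := mem_hypercube_iff.1 hy i
  rw [Real.dist_eq, abs_le]
  push_cast
  constructor <;> linarith [h1.1, h1.2, h2.1, h2.2]

end Soundness

/-! ### Completeness of the tests -/

theorem denseRange_toRealMatrix (d : ℕ) : DenseRange (toRealMatrix (d := d)) := by
  have h1 : DenseRange fun q : RatCode => (q.toRat : ℝ) :=
    Rat.denseRange_cast.comp RatCode.toRat_surjective.denseRange Rat.continuous_coe_real
  exact DenseRange.piMap fun _ => DenseRange.piMap fun _ => h1

theorem newtonDefect_nonsing_inv {d : ℕ} {T : (Fin d → ℝ) →L[ℝ] (Fin d → ℝ)} (hT : T.det ≠ 0)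
    (i l : Fin d) : newtonDefect (LinearMap.toMatrix' T.toLinearMap)⁻¹ T i l = 0 := by
  have hu : IsUnit (LinearMap.toMatrix' T.toLinearMap).det := by
    rw [LinearMap.det_toMatrix']
    exact isUnit_iff_ne_zero.2 hT
  have h := congrFun (congrFun (Matrix.nonsing_inv_mul _ hu) i) l
  rw [Matrix.mul_apply, Matrix.one_apply] at h
  rw [newtonDefect, sub_eq_zero, ← h]
  refine Finset.sum_congr rfl fun j _ => ?_
  rw [LinearMap.toMatrix'_apply]
  rfl

section Completeness

variable {d : ℕ} {K : Set (Fin d → ℝ)} {f : (Fin d → ℝ) → (Fin d → ℝ)}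
  {inside outside : ℕ → CornerCode d → Prop} {P : Fin d → PolyCode d} {k m n : ℕ}

/-- Near an invertible zero in the interior of `K`, a rational matrix close to the inverse of the
derivative makes the Newton-like map a strong contraction. -/
theorem exists_matrix_of_det_ne_zero (hf : IsC1On K f) {c : ℝ} (hc : 0 < c)
    {α : Fin d → ℝ} (hα : α ∈ interior K) (hdet : (fderiv ℝ f α).det ≠ 0) :
    ∃ (A : Fin d → Fin d → RatCode) (δ : ℝ), 0 < δ ∧ Metric.closedBall α δ ⊆ K ∧
      ∀ y ∈ Metric.closedBall α δ, ∀ i l,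
        |newtonDefect (toRealMatrix A) (fderiv ℝ f y) i l| ≤ c := by
  obtain ⟨A, hA⟩ : ∃ A : Fin d → Fin d → RatCode,
      ∀ i l, |newtonDefect (toRealMatrix A) (fderiv ℝ f α) i l| < c := by
    have hopen : IsOpen {B : Matrix (Fin d) (Fin d) ℝ |
        ∀ i l, |newtonDefect B (fderiv ℝ f α) i l| < c} := by
      simp only [Set.ofPred_forall]
      refine isOpen_iInter_of_finite fun i => isOpen_iInter_of_finite fun l =>
        isOpen_lt ?_ continuous_const
      unfold newtonDefect
      fun_prop
    obtain ⟨A, hA⟩ := (denseRange_toRealMatrix d).exists_mem_open hopen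
      ⟨(LinearMap.toMatrix' (fderiv ℝ f α).toLinearMap)⁻¹, fun i l => by
        rw [newtonDefect_nonsing_inv hdet, abs_zero]; exact hc⟩
    exact ⟨A, hA⟩
  obtain ⟨U, hU, hKU, hfU⟩ := hf
  have hcont : ContinuousAt (fderiv ℝ f) α :=
    (hfU.continuousOn_fderiv_of_isOpen hU le_rfl).continuousAt
      (hU.mem_nhds (hKU (interior_subset hα)))
  have hev : ∀ᶠ y in nhds α, ∀ i l, |newtonDefect (toRealMatrix A) (fderiv ℝ f y) i l| < c := by
    refine Filter.eventually_all.2 fun i => Filter.eventually_all.2 fun l => ?_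
    have hT : Continuous fun T => |newtonDefect (toRealMatrix A) T i l| := by
      unfold newtonDefect
      fun_prop
    exact (hT.continuousAt.comp hcont).eventually (gt_mem_nhds (hA i l))
  obtain ⟨δ, hδ, h⟩ := Metric.nhds_basis_closedBall.mem_iff.1
    (Filter.inter_mem (mem_interior_iff_mem_nhds.1 hα) hev)
  exact ⟨A, δ, hδ, fun y hy => (h hy).1, fun y hy i l => ((h hy).2 i l).le⟩

theorem isCompact_zeroSet (hK : IsCompact K) (hf : ContinuousOn f K) :
    IsCompact (zeroSet K f) := by
  have : zeroSet K f = K ∩ f ⁻¹' {0} := rfl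
  rw [this]
  exact hK.of_isClosed_subset (hf.preimage_isClosed_of_isClosed hK.isClosed isClosed_singleton)
    Set.inter_subset_left

theorem finite_of_isolated {X : Type*} [MetricSpace X] {Z : Set X} (hZ : IsCompact Z) {δ : X → ℝ}
    (hδ : ∀ α ∈ Z, 0 < δ α) (h : ∀ α ∈ Z, ∀ β ∈ Z, β ∈ Metric.closedBall α (δ α) → β = α) :
    Z.Finite := by
  obtain ⟨t, htZ, ht⟩ := hZ.elim_nhds_subcover (fun α => Metric.closedBall α (δ α))
    fun α hα => Metric.closedBall_mem_nhds α (hδ α hα)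
  refine t.finite_toSet.subset fun β hβ => ?_
  obtain ⟨α, hα, hβα⟩ := Set.mem_iUnion₂.1 (ht hβ)
  rw [h α (htZ α hα) β hβ hβα]
  exact hα

/-- Away from its zeros, a continuous function is bounded away from zero. -/
theorem exists_pos_le_norm (hK : IsCompact K) (hf : ContinuousOn f K) {r : ℝ} (hr : 0 < r) :
    ∃ μ : ℝ, 0 < μ ∧ ∀ y ∈ K, (∀ α ∈ zeroSet K f, r ≤ dist y α) → μ ≤ ‖f y‖ := by
  have hopen : IsOpen (⋃ α ∈ zeroSet K f, Metric.ball α r) :=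
    isOpen_biUnion fun _ _ => Metric.isOpen_ball
  obtain ⟨μ, hμ, h⟩ := (hK.diff hopen).exists_forall_le' (f := fun y => ‖f y‖) (a := 0)
    (hf.mono Set.sdiff_subset).norm fun y hy => by
      refine norm_pos_iff.2 fun h0 => hy.2 ?_
      exact Set.mem_iUnion₂.2 ⟨y, ⟨hy.1, h0⟩, Metric.mem_ball_self hr⟩
  refine ⟨μ, hμ, fun y hy hfar => h y ⟨hy, fun hy' => ?_⟩⟩
  obtain ⟨α, hα, hyα⟩ := Set.mem_iUnion₂.1 hy'
  exact absurd (Metric.mem_ball.1 hyα) (not_lt.2 (hfar α hα))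

theorem exists_cubeCenter_near (n : ℕ) (α : Fin d → ℝ) {ε : ℝ} (hε : 0 < ε) :
    ∃ a : CornerCode d, ∀ i, |(cubeCenter n a).toReal i - α i| ≤ ε := by
  have h (i : Fin d) :
      ∃ q : RatCode, |((q.toRat : ℚ) : ℝ) + 1 / (2 * ((n : ℝ) + 1)) - α i| ≤ ε := by
    obtain ⟨q, hq1, hq2⟩ := exists_rat_btwn
      (show α i - 1 / (2 * ((n : ℝ) + 1)) < α i - 1 / (2 * ((n : ℝ) + 1)) + ε by linarith)
    obtain ⟨c, rfl⟩ := RatCode.toRat_surjective q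
    exact ⟨c, abs_le.2 ⟨by linarith, by linarith⟩⟩
  choose a ha using h
  exact ⟨a, fun i => by rw [toReal_cubeCenter]; exact ha i⟩

/-- The factor between the bounds required here and those that the test checks is the room for the
errors of approximation. -/
theorem newtonTest_of_approx (hd : 1 ≤ d) (hf : IsC1On K f)
    (hP : IsC1Approx K f P (1 / 2 ^ k)) {e : Cell d} {α : Fin d → ℝ} (hα : f α = 0)
    (hK : Metric.closedBall α (1 / ((n : ℝ) + 1)) ⊆ K)
    (hJ : ∀ y ∈ Metric.closedBall α (1 / ((n : ℝ) + 1)), ∀ i l,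
      |newtonDefect (toRealMatrix e.2) (fderiv ℝ f y) i l| ≤ 1 / (32 * d))
    (hc : ∀ i, |(cubeCenter n e.1).toReal i - α i| ≤ 1 / (16 * ((n : ℝ) + 1)))
    (h1 : ∀ i j, (e.2 i j).bound * (1 / 2 ^ k : ℝ) ≤ 1 / (32 * ((n : ℝ) + 1) * d))
    (h2 : ∀ i j, (e.2 i j).bound * (1 / 2 ^ k : ℝ) ≤ 1 / (32 * (d : ℝ) ^ 2))
    (h3 : ∀ i j l, (e.2 i j).bound * (((P j).deriv l).lip * (1 / ((m : ℝ) + 1))) ≤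
      1 / (32 * (d : ℝ) ^ 2)) : NewtonTest P k m n e := by
  have hd' : (0 : ℝ) < d := by exact_mod_cast hd
  have hN : (0 : ℝ) < (n : ℝ) + 1 := by positivity
  have hcα : ‖(cubeCenter n e.1).toReal - α‖ ≤ 1 / (16 * ((n : ℝ) + 1)) :=
    (pi_norm_le_iff_of_nonneg (by positivity)).2 hc
  have hball : hypercube (n + 1) e.1 ⊆ Metric.closedBall α (1 / ((n : ℝ) + 1)) := by
    rw [hypercube_eq_closedBall]
    refine Metric.closedBall_subset_closedBall' ?_
    rw [dist_eq_norm]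
    refine (add_le_add_right hcα _).trans ?_
    rw [div_add_div _ _ (by positivity) (by positivity), div_le_div_iff₀ (by positivity) hN]
    nlinarith
  have hcmem : (cubeCenter n e.1).toReal ∈ Metric.closedBall α (1 / ((n : ℝ) + 1)) :=
    hball (by rw [hypercube_eq_closedBall]; exact Metric.mem_closedBall_self (by positivity))
  refine (newtonTest_iff hd).2 ⟨fun i => ?_, fun i j => ?_, fun i j l => ?_, fun t _ i l => ?_⟩
  · have hcon := norm_newtonMap_sub_le (A := toRealMatrix e.2) hd (convex_closedBall α _)
      (fun y hy => hf.hasFDerivAt (hK hy))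
      (fun y hy i l => (hJ y hy i l).trans (by gcongr; norm_num)) hcmem
      (Metric.mem_closedBall_self (by positivity))
    have hi := (norm_le_pi_norm _ i).trans hcon
    simp only [newtonMap, hα, Matrix.mulVec_zero, sub_zero, Pi.sub_apply, Real.norm_eq_abs] at hi
    have herr := abs_sum_mul_sub_sum_mul_le hd (a := toRealMatrix e.2 i)
      (u := f (cubeCenter n e.1).toReal) (v := fun j => (P j).fn (cubeCenter n e.1).toReal)
      (w := fun _ => 1 / 2 ^ k) (c := 1 / (32 * ((n : ℝ) + 1)))
      (abs_toRealMatrix_le e.2 i) (fun j => (hP _ (hK hcmem) j).1) (fun j => by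
        refine (h1 i j).trans (le_of_eq ?_)
        field_simp)
    have hmv : (toRealMatrix e.2).mulVec (f (cubeCenter n e.1).toReal) i =
      ∑ j, toRealMatrix e.2 i j * f (cubeCenter n e.1).toReal j := rfl
    rw [hmv] at hi
    have hci := hc i
    have e8 : 1 / (8 * ((n : ℝ) + 1)) = 8 * (1 / (64 * ((n : ℝ) + 1))) := by field_simp; norm_num
    have e16 : 1 / (16 * ((n : ℝ) + 1)) = 4 * (1 / (64 * ((n : ℝ) + 1))) := by
      field_simp; norm_num
    have e32 : 1 / (32 * ((n : ℝ) + 1)) = 2 * (1 / (64 * ((n : ℝ) + 1))) := by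
      field_simp; norm_num
    have h0 : 0 ≤ 1 / (64 * ((n : ℝ) + 1)) := by positivity
    rw [e8]
    rw [e16] at hci hcα
    rw [e32] at herr
    rw [abs_le] at hi herr hci ⊢
    constructor <;> linarith [hi.1, hi.2, herr.1, herr.2, hci.1, hci.2]
  · refine (h1 i j).trans ?_
    gcongr
    norm_num
  · rw [mul_add]
    refine (add_le_add (h2 i j) (h3 i j l)).trans ?_
    rw [← add_div, div_le_div_iff₀ (by positivity) (by positivity)]
    nlinarith [sq_nonneg (d : ℝ)]
  · set x := meshPoint e.1 ((n + 1) * (m + 1) - 1) (m + 2) t with hx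
    have hs : (((n + 1) * (m + 1) - 1 : ℕ) : ℝ) + 1 = ((n : ℝ) + 1) * (m + 1) := by
      exact_mod_cast Nat.sub_add_cancel (Nat.one_le_iff_ne_zero.2 (by positivity))
    have hedge : ((m + 1 : ℕ) : ℝ) / ((((n + 1) * (m + 1) - 1 : ℕ) : ℝ) + 1) =
        1 / ((n : ℝ) + 1) := by
      rw [hs]; push_cast; field_simp
    have hxmem := hball (mem_hypercube_iff.2 (by
      have := meshPoint_mem e.1 ((n + 1) * (m + 1) - 1) (m + 1) t
      rw [hedge] at this; exact this))
    rw [← hx] at hxmem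
    have herr := abs_sum_mul_sub_sum_mul_le hd (a := toRealMatrix e.2 i)
      (u := fun j => fderiv ℝ f x.toReal (Pi.single l 1) j)
      (v := fun j => ((P j).deriv l).fn x.toReal)
      (w := fun _ => 1 / 2 ^ k) (c := 1 / (32 * d))
      (abs_toRealMatrix_le e.2 i) (fun j => (hP _ (hK hxmem) j).2 l) (fun j => by
        refine (h2 i j).trans (le_of_eq ?_)
        field_simp)
    have hJx := hJ _ hxmem i l
    rw [newtonDefect] at hJx
    have e8 : 1 / (8 * (d : ℝ)) = 4 * (1 / (32 * (d : ℝ))) := by field_simp; norm_num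
    have h0 : 0 ≤ 1 / (32 * (d : ℝ)) := by positivity
    rw [e8]
    rw [abs_le] at hJx herr ⊢
    constructor <;> linarith [hJx.1, hJx.2, herr.1, herr.2]

/-- A mesh point that is not away from `K` has a point `y` of `K` nearby. If `y` is close to a zero,
the mesh point is well inside the cube of that zero; otherwise `f`, hence `P`, is large. -/
theorem coverTest_of_approx (T : BallTests K inside outside) (hP : IsC1Approx K f P (1 / 2 ^ k))
    {L : List (Cell d)} {μ : ℝ}
    (hμ : ∀ y ∈ K, (∀ α ∈ zeroSet K f, 1 / (4 * ((n : ℝ) + 1)) ≤ dist y α) → μ ≤ ‖f y‖)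
    (hμ0 : 0 < μ)
    (hL : ∀ α ∈ zeroSet K f, ∃ e ∈ L, ∀ i,
      |(cubeCenter n e.1).toReal i - α i| ≤ 1 / (16 * ((n : ℝ) + 1)))
    (hk : (1 / 2 ^ k : ℝ) ≤ μ / 8)
    (hm : ∀ i, ((P i).lip : ℝ) * ((d + 1) / ((m : ℝ) + 1)) ≤ μ / 8)
    (hm' : ((d : ℝ) + 1) / ((m : ℝ) + 1) ≤ 1 / (8 * ((n : ℝ) + 1))) :
    CoverTest outside P k m n L := by
  intro t _
  set x := meshPoint (d := d) (fun _ => (0, 1, 0)) m (2 * (m + 1) + 1) t with hx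
  by_cases hout : outside m x
  · exact Or.inl hout
  refine Or.inr ?_
  have hx1 (i : Fin d) : |x.toReal i| ≤ 1 := by
    have ha : CornerCode.toReal (d := d) (fun _ => (0, 1, 0)) = fun _ => -1 := by
      funext i; simp [CornerCode.toReal, RatCode.toRat]
    have hedge : (-1 : ℝ) + ((2 * (m + 1) : ℕ) : ℝ) / ((m : ℝ) + 1) = 1 := by
      push_cast; field_simp; norm_num
    have := meshPoint_mem (d := d) (fun _ => (0, 1, 0)) m (2 * (m + 1)) t i
    rw [ha, hedge] at this
    exact abs_le.2 this
  obtain ⟨y, hy, hyx⟩ := T.outside_complete m x hout hx1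
  have hsplit : ((d : ℝ) + 1) / ((m : ℝ) + 1) = d / ((m : ℝ) + 1) + 1 / ((m : ℝ) + 1) := add_div ..
  by_cases hfar : ∀ α ∈ zeroSet K f, 1 / (4 * ((n : ℝ) + 1)) ≤ dist y α
  · left
    have hy' := hμ y hy hfar
    obtain ⟨i, hi⟩ : ∃ i, μ ≤ |f y i| := by
      by_contra! h
      exact absurd ((pi_norm_lt_iff hμ0).2 h) (not_lt.2 hy')
    refine nonzeroTest_iff.2 ⟨i, ?_⟩
    have e1 := (hP y hy i).1
    have e2 := (P i).abs_fn_sub_le (T.abs_le y hy) hx1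
    have e3 : ‖y - x.toReal‖ ≤ d / ((m : ℝ) + 1) :=
      (pi_norm_le_iff_of_nonneg (by positivity)).2 hyx
    have e4 := mul_le_mul_of_nonneg_left e3 ((P i).lip.cast_nonneg (α := ℝ))
    have e5 := hm i
    rw [hsplit, mul_add] at e5
    have e6 : (0 : ℝ) ≤ (P i).lip * (1 / ((m : ℝ) + 1)) := by positivity
    have e7 : (0 : ℝ) ≤ (P i).lip * (d / ((m : ℝ) + 1)) := by positivity
    have e8 := abs_sub_abs_le_abs_sub (f y i) ((P i).fn y)
    have e9 := abs_sub_abs_le_abs_sub ((P i).fn y) ((P i).fn x.toReal)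
    linarith
  · right
    push Not at hfar
    obtain ⟨α, hα, hyα⟩ := hfar
    obtain ⟨e, he, hc⟩ := hL α hα
    refine interiorTest_iff.2 ⟨e, he, fun i => ?_⟩
    have e1 := abs_le.1 (hyx i)
    have e2 := abs_le.1 (((dist_le_pi_dist y α i).trans hyα.le).trans' (Real.dist_eq _ _).ge)
    have e3 := abs_le.1 (hc i)
    rw [toReal_cubeCenter] at e3
    rw [hsplit] at hm'
    have h0 : 0 ≤ 1 / (16 * ((n : ℝ) + 1)) := by positivity
    have f1 : 1 / ((n : ℝ) + 1) = 16 * (1 / (16 * ((n : ℝ) + 1))) := by field_simp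
    have f2 : 1 / (2 * ((n : ℝ) + 1)) = 8 * (1 / (16 * ((n : ℝ) + 1))) := by field_simp; norm_num
    have f4 : 1 / (4 * ((n : ℝ) + 1)) = 4 * (1 / (16 * ((n : ℝ) + 1))) := by field_simp; norm_num
    have f8 : 1 / (8 * ((n : ℝ) + 1)) = 2 * (1 / (16 * ((n : ℝ) + 1))) := by field_simp; norm_num
    rw [f1]
    rw [f2] at e3
    rw [f4] at e2
    rw [f8] at hm'
    constructor <;> linarith [e1.1, e1.2, e2.1, e2.2, e3.1, e3.2]

end Completeness

/-! ### Correctness of the search -/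

theorem eventually_mul_two_pow_le (b : ℝ) {c : ℝ} (hc : 0 < c) :
    ∀ᶠ k : ℕ in Filter.atTop, b * (1 / 2 ^ k) ≤ c := by
  have h := (tendsto_pow_atTop_nhds_zero_of_lt_one (r := (1 / 2 : ℝ)) (by norm_num)
    (by norm_num)).const_mul b
  rw [mul_zero] at h
  filter_upwards [h.eventually (ge_mem_nhds hc)] with k hk
  simpa using hk

theorem eventually_mul_div_le (b a : ℝ) {c : ℝ} (hc : 0 < c) :
    ∀ᶠ m : ℕ in Filter.atTop, b * (a / ((m : ℝ) + 1)) ≤ c := by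
  obtain ⟨m₁, h⟩ := exists_forall_ge_div_le hc (b * a)
  filter_upwards [Filter.eventually_ge_atTop m₁] with m hm
  rw [← mul_div_assoc]
  exact h m hm

section Correctness

variable {d : ℕ} {K : Set (Fin d → ℝ)} {f : (Fin d → ℝ) → (Fin d → ℝ)}
  {inside outside : ℕ → CornerCode d → Prop} {P : ℕ → Fin d → PolyCode d}

/-- The search succeeds. The parameters of the certificate are chosen one after the other: the
side of the cubes from the zeros of `f`, then the precision of the approximation, and last the width
of the meshes, which has to be small against the Lipschitz constants of the chosen polynomials. -/
theorem exists_accepts (hd : 1 ≤ d) (T : BallTests K inside outside)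
    (hf : f ∈ invertibleZeroClass K) (hP : IsC1Name K f P) (n₀ : ℕ) :
    ∃ c : Certificate d, Accepts inside outside (P c.1) n₀ c := by
  obtain ⟨hC1, hZ⟩ := hf
  have hd' : (0 : ℝ) < d := by exact_mod_cast hd
  have hcont : ContinuousOn f K := fun y hy =>
    (hC1.hasFDerivAt hy).continuousAt.continuousWithinAt
  have hint (α) (hα : α ∈ zeroSet K f) : α ∈ interior K := by
    by_contra h
    exact (hZ α hα).2 ⟨subset_closure hα.1, h⟩
  have hloc (α) (hα : α ∈ zeroSet K f) := exists_matrix_of_det_ne_zero hC1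
    (c := 1 / (32 * d)) (by positivity) (hint α hα) (hZ α hα).1
  choose! A δ hδ hδK hJ using hloc
  have hiso : ∀ α ∈ zeroSet K f, ∀ β ∈ zeroSet K f, β ∈ Metric.closedBall α (δ α) → β = α :=
    fun α hα β hβ hβα => eq_of_newton (A := toRealMatrix (A α)) hd (convex_closedBall _ _)
      (fun y hy => hC1.hasFDerivAt (hδK α hα hy))
      (fun y hy i l => (hJ α hα y hy i l).trans (by gcongr; norm_num)) hβα
      (Metric.mem_closedBall_self (hδ α hα).le) hβ.2 hα.2
  have hfin := finite_of_isolated (isCompact_zeroSet T.isCompact hcont) hδ hiso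
  -- The side of the cubes.
  obtain ⟨n, hn₀, hn⟩ : ∃ n, n₀ ≤ n ∧ ∀ α ∈ zeroSet K f, 3 * (1 / ((n : ℝ) + 1)) ≤ δ α ∧
      ∀ a, α ∈ hypercube (n + 1) a → inside n a := by
    refine ((Filter.eventually_ge_atTop n₀).and ((Filter.eventually_all_finite hfin).2
      fun α hα => (eventually_mul_div_le 3 1 (hδ α hα)).and ?_)).exists
    obtain ⟨n₁, h⟩ := T.inside_complete α (hint α hα)
    filter_upwards [Filter.eventually_ge_atTop n₁] with n hn using h n hn
  have hN : (0 : ℝ) < (n : ℝ) + 1 := by positivity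
  -- The cubes.
  choose a ha using fun α : Fin d → ℝ =>
    exists_cubeCenter_near n α (ε := 1 / (16 * ((n : ℝ) + 1))) (by positivity)
  have hmem (α : Fin d → ℝ) : α ∈ hypercube (n + 1) (a α) := by
    rw [hypercube_eq_closedBall, mem_closedBall_iff_norm,
      pi_norm_le_iff_of_nonneg (by positivity)]
    intro i
    rw [Pi.sub_apply, Real.norm_eq_abs, abs_sub_comm]
    refine (ha α i).trans ?_
    gcongr
    norm_num
  let L : List (Cell d) := hfin.toFinset.toList.map fun α => (a α, A α)
  have hL (e : Cell d) : e ∈ L ↔ ∃ α ∈ zeroSet K f, (a α, A α) = e := by simp [L]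
  have hsep : L.Pairwise fun e e' => Separated n e.1 e'.1 := by
    refine List.pairwise_map.2 ?_
    refine (Finset.nodup_toList _).imp_of_mem fun {α β} hα hβ hαβ => ?_
    rw [Finset.mem_toList, Set.Finite.mem_toFinset] at hα hβ
    -- Distinct zeros have a distance of more than three sides.
    have hdist : 3 * (1 / ((n : ℝ) + 1)) < dist α β := by
      rw [dist_comm]
      by_contra! h
      exact hαβ (hiso α hα β hβ (Metric.mem_closedBall.2 (h.trans (hn α hα).1))).symm
    obtain ⟨i, hi⟩ : ∃ i, 3 * (1 / ((n : ℝ) + 1)) < |α i - β i| := by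
      by_contra! h
      exact absurd ((dist_pi_le_iff (by positivity)).2 h) (not_le.2 hdist)
    have h1 := mem_hypercube_iff.1 (hmem α) i
    have h2 := mem_hypercube_iff.1 (hmem β) i
    refine separated_iff.2 ⟨i, ?_⟩
    have h0 : 0 < 1 / ((n : ℝ) + 1) := by positivity
    rcases lt_abs.1 hi with h | h
    · right; linarith [h1.1, h1.2, h2.1, h2.2]
    · left; linarith [h1.1, h1.2, h2.1, h2.2]
  obtain ⟨μ, hμ0, hμ⟩ := exists_pos_le_norm T.isCompact hcont
    (r := 1 / (4 * ((n : ℝ) + 1))) (by positivity)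
  -- The precision of the approximation.
  obtain ⟨k, hk, hk1⟩ : ∃ k : ℕ, 1 * (1 / 2 ^ k : ℝ) ≤ μ / 8 ∧ ∀ α ∈ zeroSet K f, ∀ i j,
      (A α i j).bound * (1 / 2 ^ k : ℝ) ≤ 1 / (32 * ((n : ℝ) + 1) * d) ∧
      (A α i j).bound * (1 / 2 ^ k : ℝ) ≤ 1 / (32 * (d : ℝ) ^ 2) :=
    ((eventually_mul_two_pow_le 1 (by positivity)).and ((Filter.eventually_all_finite hfin).2
      fun α _ => Filter.eventually_all.2 fun i => Filter.eventually_all.2 fun j =>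
        (eventually_mul_two_pow_le _ (by positivity)).and
          (eventually_mul_two_pow_le _ (by positivity)))).exists
  -- The width of the meshes, which depends on the approximation.
  obtain ⟨m, hm, hm1, hm2⟩ : ∃ m : ℕ,
      1 * (((d : ℝ) + 1) / ((m : ℝ) + 1)) ≤ 1 / (8 * ((n : ℝ) + 1)) ∧
      (∀ i, ((P k i).lip : ℝ) * ((d + 1) / ((m : ℝ) + 1)) ≤ μ / 8) ∧
      ∀ α ∈ zeroSet K f, ∀ i j l, (A α i j).bound * ((P k j).deriv l).lip *
        (1 / ((m : ℝ) + 1)) ≤ 1 / (32 * (d : ℝ) ^ 2) :=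
    ((eventually_mul_div_le 1 _ (by positivity)).and ((Filter.eventually_all.2 fun i =>
      eventually_mul_div_le _ _ (by positivity)).and ((Filter.eventually_all_finite hfin).2
        fun α _ => Filter.eventually_all.2 fun i => Filter.eventually_all.2 fun j =>
          Filter.eventually_all.2 fun l => eventually_mul_div_le _ _ (by positivity)))).exists
  rw [one_mul] at hk hm
  have hPk := hP.isC1Approx hC1 k
  refine ⟨(k, m, n, L), Nat.le_succ_of_le hn₀, hsep, fun e he => ?_, ?_⟩
  · obtain ⟨α, hα, rfl⟩ := (hL e).1 he
    have hsub : Metric.closedBall α (1 / ((n : ℝ) + 1)) ⊆ Metric.closedBall α (δ α) := by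
      refine Metric.closedBall_subset_closedBall ((hn α hα).1.trans' ?_)
      have : 0 < 1 / ((n : ℝ) + 1) := by positivity
      linarith
    exact ⟨(hn α hα).2 _ (hmem α), newtonTest_of_approx hd hC1 hPk hα.2
      (hsub.trans (hδK α hα)) (fun y hy => hJ α hα y (hsub hy)) (ha α)
      (fun i j => (hk1 α hα i j).1) (fun i j => (hk1 α hα i j).2)
      (fun i j l => by rw [← mul_assoc]; exact hm2 α hα i j l)⟩
  · exact coverTest_of_approx T hPk hμ hμ0
      (fun α hα => ⟨(a α, A α), (hL _).2 ⟨α, hα, rfl⟩, ha α⟩) hk hm1 hm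

/-- The search for a certificate computes the zero set of every function in the class. -/
theorem zeroFinder_correct (hd : 1 ≤ d) (T : BallTests K inside outside)
    (hf : f ∈ invertibleZeroClass K) (hP : IsC1Name K f P) (n₀ : ℕ) :
    ∃ (n N : ℕ) (C : List (CornerCode d)), (n, N, C) ∈ zeroFinder inside outside P n₀ ∧
      0 < n ∧ n₀ ≤ n ∧ (zeroSet K f).encard = (N : ℕ∞) ∧
      (∀ a ∈ C, hypercube n a ⊆ K ∧ ∃! x, x ∈ hypercube n a ∧ x ∈ zeroSet K f) ∧
      zeroSet K f ⊆ ⋃ a ∈ C, hypercube n a ∧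
      Metric.hausdorffEDist (zeroSet K f) (⋃ a ∈ C, hypercube n a) ≤
        ENNReal.ofReal (1 / (n : ℝ)) := by
  obtain ⟨⟨k, m, n, L⟩, ⟨hn, hsep, hcells, hcover⟩, hmem⟩ :=
    exists_mem_searchFor (out := fun c : Certificate d =>
      (c.2.2.1 + 1, c.2.2.2.length, c.2.2.2.map Prod.fst)) (exists_accepts hd T hf hP n₀)
  have hPk := hP.isC1Approx hf.1 k
  have hsub (e : Cell d) (he : e ∈ L) : hypercube (n + 1) e.1 ⊆ K :=
    T.inside_sound n e.1 (hcells e he).1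
  have hex (e : Cell d) (he : e ∈ L) :
      ∃! x, x ∈ hypercube (n + 1) e.1 ∧ x ∈ zeroSet K f :=
    (hcells e he).2.existsUnique hd T.abs_le hf.1 hPk (hsub e he)
  have hcov (y) (hy : y ∈ zeroSet K f) : ∃ e ∈ L, y ∈ hypercube (n + 1) e.1 :=
    hcover.subset T hPk hy
  have hcov' : zeroSet K f ⊆ ⋃ a ∈ L.map Prod.fst, hypercube (n + 1) a := by
    intro y hy
    obtain ⟨e, he, hye⟩ := hcov y hy
    exact Set.mem_iUnion₂.2 ⟨e.1, List.mem_map_of_mem he, hye⟩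
  have hC (a) (ha : a ∈ L.map Prod.fst) : hypercube (n + 1) a ⊆ K ∧
      ∃! x, x ∈ hypercube (n + 1) a ∧ x ∈ zeroSet K f := by
    obtain ⟨e, he, rfl⟩ := List.mem_map.1 ha
    exact ⟨hsub e he, hex e he⟩
  exact ⟨n + 1, L.length, L.map Prod.fst, hmem, n.succ_pos, hn,
    encard_zeroSet_eq_length hsep hex hcov, hC, hcov',
    hausdorffEDist_iUnion_hypercube_le (fun a ha => (hC a ha).2.exists) hcov'⟩

end Correctness

theorem theorem2 (d : ℕ) (hd : 1 ≤ d) (K : Set (Fin d → ℝ))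
    (hK : K = maxUnitBall d ∨ K = euclideanUnitBall d) :
    ∃ E : (ℕ → Fin d → PolyCode d) → ℕ →. ℕ × ℕ × List (CornerCode d),
      IsAlgorithm E ∧
      ∀ f ∈ invertibleZeroClass K, ∀ P : ℕ → Fin d → PolyCode d, IsC1Name K f P →
        ∀ n₀ : ℕ, ∃ (n N : ℕ) (C : List (CornerCode d)),
          (n, N, C) ∈ E P n₀ ∧
          0 < n ∧ n₀ ≤ n ∧
          (zeroSet K f).encard = (N : ℕ∞) ∧
          (∀ a ∈ C, hypercube n a ⊆ K ∧ ∃! x, x ∈ hypercube n a ∧ x ∈ zeroSet K f) ∧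
          zeroSet K f ⊆ ⋃ a ∈ C, hypercube n a ∧
          Metric.hausdorffEDist (zeroSet K f) (⋃ a ∈ C, hypercube n a) ≤
            ENNReal.ofReal (1 / (n : ℝ)) := by
  obtain ⟨inside, outside, T⟩ : ∃ inside outside, BallTests K inside outside := by
    rcases hK with rfl | rfl
    · exact ⟨_, _, ballTests_maxUnitBall d⟩
    · exact ⟨_, _, ballTests_euclideanUnitBall d⟩
  exact ⟨zeroFinder inside outside, isAlgorithm_zeroFinder T.primrec_inside T.primrec_outside,
    fun f hf P hP n₀ => zeroFinder_correct hd T hf hP n₀⟩
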